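/- There is an absolute constant $K>0$ such that the following holds for every $m\ge 1$. A seller offers $m$ items to a single additive buyer. The buyer's values $t_1,\dots,t_m\ge 0$ are independent, $t_j\sim D_j$; the seller's cost vector $c=(c_1,\dots,c_m)\in[0,\infty)^m$ is drawn from a distribution $\mathcal C$ (the coordinates may be correlated), independently of $t$. The $D_j$ and $\mathcal C$ are arbitrary Borel probability distributions; let $T=\prod_j\mathrm{supp}(D_j)$. A direct mechanism consists of measurable maps $x(t,c)\in[0,1]^m$ and $p(t,c)\in\mathbb R$ (with $p(t,\cdot)$ $\mathcal C$-integrable for each $t\in T$). It is BIC if $\mathbb E_c[t\cdot x(t,c)-p(t,c)]\ge \mathbb E_c[t\cdot x(t',c)-p(t',c)]$ for all $t,t'\in T$, and interim IR if $\mathbb E_c[t\cdot x(t,c)-p(t,c)]\ge 0$ for all $t\in T$; its profit is $\mathbb E_{t,c}[p(t,c)-c\cdot x(t,c)]$. Let * $\mathrm{OPT}\in[0,\infty]$ be the supremum of the profit over all BIC, interim IR direct mechanisms, and $\mathrm{OPT}(\{j\})$ the same quantity when only item $j$ is for sale (value distribution $D_j$, cost distribution the $j$-th marginal of $\mathcal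 C$); * $\mathrm{IP}$ be the supremum of the profit over item posted pricings: for measurable prices $p_j(c)$, the buyer takes each item $j$ with $t_j\ge p_j(c)$ and pays $p_j(c)$ for it; * $\mathrm{PP}$ be the supremum of the profit over permit posted pricings: for permit prices $\ell_j$ that do not depend on $c$, the buyer buys the permit for each item $j$ with $\mathbb E_c[(t_j-c_j)^+]\ge \ell_j$ at price $\ell_j$; then $c$ is revealed, and she buys each item $j$ whose permit she owns and for which $t_j\ge c_j$, at price $c_j$. Then $$\mathrm{OPT}\le \mathrm{IP}+K\log(m)\cdot \mathrm{PP},\qquad \mathrm{OPT}\le K(1+\log m)\sum_{j=1}^m \mathrm{OPT}(\{j\}).$$ Moreover, for every $j$ with $\lim_{v\to\infty}v\Pr[t_j\ge v]=0$ (in particular whenever $\mathbb E[t_j]<\infty$), $$\mathrm{OPT}(\{j\})=\mathbb E_{t_j,c_j}\big[(\tilde\varphi_j(t_j)-c_j)^+\big],$$ where $\tilde\varphi_j$ is Myerson's ironed virtual value for $D_j$: $\tilde\varphi_j(v)$ is the left derivative at $q=\Pr[t_j\ge v]$ of the least concave majorant on $[0,1]$ of the revenue curve $R_j(q)=q\cdot\sup\{v:\Pr[t_j\ge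 v]\ge q\}$. -/

import Mathlib

open MeasureTheory Filter Topology
open scoped ENNReal

noncomputable section

namespace ProfitMax

/-! ### Direct mechanisms for one additive buyer

`ι` is the (finite) set of items.  The buyer's type is `t : ι → ℝ`, with independent coordinates
`t j ∼ D j`; the seller's cost vector is `c : ι → ℝ`, drawn from the (possibly correlated)
distribution `C`, independently of `t`. -/

/-- The data of a direct mechanism: `alloc t c j` is the probability that the buyer receives item
`j`, and `pay t c` is her (expected) payment, when the reported type is `t` and the cost vector is
`c`. -/
structure DirectMechanism (ι : Type*) where
  alloc : (ι → ℝ) → (ι → ℝ) → ι → ℝ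
  pay : (ι → ℝ) → (ι → ℝ) → ℝ

variable {ι : Type*} [Fintype ι]

/-- The type space: the product of the supports of the item distributions. -/
def typeSpace (D : ι → Measure ℝ) : Set (ι → ℝ) :=
  {t | ∀ j, t j ∈ (D j).support}

/-- Expected utility, over the seller's costs, of an additive buyer whose true type is `t` and who
reports `t'`. -/
def interimUtility (C : Measure (ι → ℝ)) (M : DirectMechanism ι) (t t' : ι → ℝ) : ℝ :=
  ∫ c, ((∑ j, t j * M.alloc t' c j) - M.pay t' c) ∂C

/-- `M` is a well-defined direct mechanism that is Bayesian incentive compatible and interim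
individually rational. -/
structure IsBICIR (D : ι → Measure ℝ) (C : Measure (ι → ℝ)) (M : DirectMechanism ι) : Prop where
  measurable_alloc : ∀ j, Measurable fun z : (ι → ℝ) × (ι → ℝ) => M.alloc z.1 z.2 j
  measurable_pay : Measurable fun z : (ι → ℝ) × (ι → ℝ) => M.pay z.1 z.2
  alloc_mem : ∀ t c j, M.alloc t c j ∈ Set.Icc (0 : ℝ) 1
  integrable_pay : ∀ t ∈ typeSpace D, Integrable (M.pay t) C
  bic : ∀ t ∈ typeSpace D, ∀ t' ∈ typeSpace D,
    interimUtility C M t t' ≤ interimUtility C M t t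
  ir : ∀ t ∈ typeSpace D, 0 ≤ interimUtility C M t t

/-- The expectation of `g` as an extended real: the integral of the positive part minus the integral
of the negative part.  It is `⊥` if both are infinite. -/
def extExpectation {Ω : Type*} [MeasurableSpace Ω] (μ : Measure Ω) (g : Ω → ℝ) : EReal :=
  ((∫⁻ z, ENNReal.ofReal (g z) ∂μ : ℝ≥0∞) : EReal) -
    ((∫⁻ z, ENNReal.ofReal (-g z) ∂μ : ℝ≥0∞) : EReal)

/-- Expected profit of the seller, `E[p(t,c) - c · x(t,c)]`. -/
def profit (D : ι → Measure ℝ) (C : Measure (ι → ℝ)) (M : DirectMechanism ι) : EReal :=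
  extExpectation ((Measure.pi D).prod C)
    fun z => M.pay z.1 z.2 - ∑ j, z.2 j * M.alloc z.1 z.2 j

/-- Optimal profit among all BIC and interim IR direct mechanisms. -/
def optProfit (D : ι → Measure ℝ) (C : Measure (ι → ℝ)) : EReal :=
  ⨆ (M : DirectMechanism ι) (_ : IsBICIR D C M), profit D C M

/-- Optimal profit when only the items in `S` are for sale. -/
def optProfitOn (D : ι → Measure ℝ) (C : Measure (ι → ℝ)) (S : Finset ι) : EReal :=
  optProfit (fun j : S => D j) (C.map fun c (j : S) => c j)

/-! ### Item posted pricing and permit posted pricing -/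

/-- Facing additive values `v` and separate prices `p`, an additive buyer maximizes her utility by
taking exactly the items with `p j ≤ v j`. -/
theorem bundle_utility_le (v p : ι → ℝ) (S : Finset ι) :
    ∑ j ∈ S, (v j - p j) ≤ ∑ j, if p j ≤ v j then v j - p j else 0 := by
  calc ∑ j ∈ S, (v j - p j) ≤ ∑ j ∈ S, if p j ≤ v j then v j - p j else 0 := by
        refine Finset.sum_le_sum fun j _ => ?_
        split_ifs with h
        · exact le_rfl
        · linarith [not_le.mp h]
    _ ≤ ∑ j, if p j ≤ v j then v j - p j else 0 := by
        refine Finset.sum_le_univ_sum_of_nonneg fun j => ?_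
        split_ifs with h
        · linarith
        · exact le_rfl

/-- Item posted pricing: given the cost vector `c`, each item `j` is offered at price `p c j`. -/
def itemPricing (p : (ι → ℝ) → ι → ℝ) : DirectMechanism ι where
  alloc t c j := if p c j ≤ t j then 1 else 0
  pay t c := ∑ j, if p c j ≤ t j then p c j else 0

/-- Optimal profit of item posted pricing; the prices may depend on the whole cost vector. -/
def ipProfit (D : ι → Measure ℝ) (C : Measure (ι → ℝ)) : EReal :=
  ⨆ (p : (ι → ℝ) → ι → ℝ) (_ : Measurable p), profit D C (itemPricing p)

/-- The value `E_c[(x - c_j)⁺]` of the permit for item `j` to a buyer with value `x` for item `j`,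
when a permit gives the right to buy the item at its cost.  The value of a set of permits to an
additive buyer is the sum of the values of its elements. -/
def permitValue (C : Measure (ι → ℝ)) (j : ι) (x : ℝ) : ℝ :=
  ∫ c, max (x - c j) 0 ∂C

/-- Permit posted pricing: before the costs are revealed, the permit for each item `j` is offered at
price `l j`; then the costs are revealed, and the buyer may buy every item whose permit she owns at
a price equal to its cost. -/
def permitPricing (C : Measure (ι → ℝ)) (l : ι → ℝ) : DirectMechanism ι where
  alloc t c j := if l j ≤ permitValue C j (t j) ∧ c j ≤ t j then 1 else 0
  pay t c := ∑ j, ((if l j ≤ permitValue C j (t j) then l j else 0) +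
    if l j ≤ permitValue C j (t j) ∧ c j ≤ t j then c j else 0)

/-- Optimal profit of permit posted pricing. -/
def ppProfit (D : ι → Measure ℝ) (C : Measure (ι → ℝ)) : EReal :=
  ⨆ l : ι → ℝ, profit D C (permitPricing C l)

/-! ### Myerson's ironed virtual value -/

/-- Quantile function: the largest price at which the probability of sale is at least `q`. -/
def priceAt (μ : Measure ℝ) (q : ℝ) : ℝ :=
  sSup {v : ℝ | q ≤ μ.real (Set.Ici v)}

/-- The revenue curve in quantile space. -/
def revenueCurve (μ : Measure ℝ) (q : ℝ) : ℝ :=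
  q * priceAt μ q

/-- The ironed revenue curve: the least concave majorant on `[0,1]` of the revenue curve. -/
def ironedRevenueCurve (μ : Measure ℝ) (q : ℝ) : ℝ :=
  sInf {y : ℝ | ∃ g : ℝ → ℝ, ConcaveOn ℝ (Set.Icc 0 1) g ∧
    (∀ x ∈ Set.Icc (0 : ℝ) 1, revenueCurve μ x ≤ g x) ∧ y = g q}

/-- Myerson's ironed virtual value: the slope of the ironed revenue curve at the quantile
`Pr[t ≥ v]`.  The left derivative is the slope on the interval `[Pr[t > v], Pr[t ≥ v]]` if `v` is an
atom of `μ`. -/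
def ironedVirtualValue (μ : Measure ℝ) (v : ℝ) : ℝ :=
  derivWithin (ironedRevenueCurve μ) (Set.Iio (μ.real (Set.Ici v))) (μ.real (Set.Ici v))

end ProfitMax

end

set_option linter.unusedSectionVars false

noncomputable section

namespace ProfitMax

/-! ### Two real-variable lemmas -/

/-! The profit of a mechanism at a type `t` is the sum over items of the expected surplus `E_c[(t_j
- c_j) x_j]`, minus the buyer's utility `U(t)`. Let `j` be an item whose permit value `E_c[(t_j -
c_j)⁺]` is largest. Charge all of `U` to `j`, and bound the surplus of every other item by its
permit value. This gives OPT ≤ (sum of single-item profits) + (sum of overlaps), an overlap being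
the expected permit value of an item where another item's is at least as large (`optProfit_le`).

Single-item term. Freezing the other coordinates leaves a single-item mechanism with interim
allocation `X` and utility `U`. Let `θ(y)` be the least type with allocation at least `y`, and `γ`
the increasing quantile function of the cost. Incentive compatibility gives `s X(s) - U(s) ≤
∫_0^{X(s)} θ` (`payment_le_integral`), and rearrangement gives a production cost of at least
`∫_0^{X(s)} γ` (`integral_costAt_le`). After integrating over `s`, level `y` contributes at most
`(θ(y) - γ(y))⁺ Pr[t_j ≥ θ(y)]`, which is at most the best posted-price profit at cost `γ(y)`. As
`γ` transports the uniform law to the cost law, the total is `singleProfit`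
(`lintegral_surplus_le`). Posted prices chosen measurably in `c` collect these profits for all items
at once (`sum_singleProfit_le`), so their sum is at most IP.

Overlap term. Let `r_j` be the best revenue from posting a price for permit `j`, and `r = ∑ r_j`. A
union bound and independence bound the overlap of `k` by `E[min(v_k, r)]`, where `v_k` is its permit
value (`overlap_le_lintegral_min`). Since `Pr[v_k ≥ l] ≤ r_k / l`, the layer-cake formula cut at
`r/m` gives `r/m + r_k log m` (`lintegral_min_le`). The sum over `k` is `(1 + log m) r`, and `r ≤
PP`. For `m = 1` overlaps vanish; for `m ≥ 2`, `1 + log m ≤ 3 log m`. Item and permit pricing are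
feasible for each item alone, which yields the second inequality.

Myerson's formula. With one item, OPT equals `singleProfit`. At cost `c` the best posted price earns
the supremum of `R(q) - c q`, which ironing does not change. It equals `∫_0^1 (R̄'(q) - c)⁺ dq`,
where `R̄` is the ironed curve; the decay of `v Pr[t ≥ v]` makes `R̄` vanish at `0+`. Transport
along the quantile function turns this into an expectation over the value. -/

theorem le_of_sub_le_mul_sub {F Θ : ℝ → ℝ} {a b : ℝ} (hab : a ≤ b)
    (h : ∀ x y, a ≤ x → x ≤ y → y ≤ b → F y - F x ≤ (y - x) * (Θ y - Θ x)) : F b ≤ F a := by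
  -- Cut `[a, b]` into `n + 1` equal pieces. Both sides telescope, and the right-hand side keeps one
  -- factor equal to the mesh, which tends to `0`. No regularity of `F` or `Θ` is needed.
  have key : ∀ n : ℕ, F b - F a ≤ (b - a) * (Θ b - Θ a) / ((n : ℝ) + 1) := by
    intro n
    have hn : (0 : ℝ) < (n : ℝ) + 1 := by positivity
    set d : ℝ := (b - a) / ((n : ℝ) + 1) with hd
    have hd0 : 0 ≤ d := div_nonneg (by linarith) hn.le
    have hdn : ((n : ℝ) + 1) * d = b - a := by rw [hd]; field_simp
    have hend : ∀ H : ℝ → ℝ, ∑ i ∈ Finset.range (n + 1),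
        (H (a + ((i + 1 : ℕ) : ℝ) * d) - H (a + (i : ℝ) * d)) = H b - H a := by
      intro H
      rw [Finset.sum_range_sub fun i : ℕ => H (a + (i : ℝ) * d)]
      push_cast
      rw [hdn]
      simp
    rw [← hend F]
    have hstep : ∀ i ∈ Finset.range (n + 1),
        F (a + ((i + 1 : ℕ) : ℝ) * d) - F (a + (i : ℝ) * d)
          ≤ d * (Θ (a + ((i + 1 : ℕ) : ℝ) * d) - Θ (a + (i : ℝ) * d)) := by
      intro i hi
      have hi' : ((i : ℝ) + 1) ≤ (n : ℝ) + 1 := by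
        have := Finset.mem_range.mp hi
        exact_mod_cast this
      have h1 := h (a + (i : ℝ) * d) (a + ((i + 1 : ℕ) : ℝ) * d)
        (by have : 0 ≤ (i : ℝ) * d := by positivity
            linarith)
        (by push_cast; nlinarith)
        (by push_cast
            have := mul_le_mul_of_nonneg_right hi' hd0
            linarith)
      have h2 : a + ((i + 1 : ℕ) : ℝ) * d - (a + (i : ℝ) * d) = d := by push_cast; ring
      rwa [h2] at h1
    refine (Finset.sum_le_sum hstep).trans (le_of_eq ?_)
    rw [← Finset.mul_sum, hend Θ, hd]
    ring
  have hlim : Tendsto (fun n : ℕ => (b - a) * (Θ b - Θ a) / ((n : ℝ) + 1)) atTop (𝓝 0) :=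
    tendsto_const_nhds.div_atTop (tendsto_atTop_add_const_right _ _ tendsto_natCast_atTop_atTop)
  linarith [ge_of_tendsto' hlim key]

/-- The least type in `B` whose allocation is at least `y`. -/
def leastType (B : Set ℝ) (X : ℝ → ℝ) (y : ℝ) : ℝ :=
  sInf {s | s ∈ B ∧ y ≤ X s}

section SingleItem

variable {B : Set ℝ} {X U : ℝ → ℝ}

theorem leastType_le (hB : ∀ s ∈ B, 0 ≤ s) {s y : ℝ} (hs : s ∈ B) (hy : y ≤ X s) :
    leastType B X y ≤ s :=
  csInf_le ⟨0, fun _ h => hB _ h.1⟩ ⟨hs, hy⟩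

theorem leastType_monotoneOn (hB : ∀ s ∈ B, 0 ≤ s) {s : ℝ} (hs : s ∈ B) :
    MonotoneOn (leastType B X) (Set.Iic (X s)) := fun _ _ _ hy2 hy =>
  csInf_le_csInf ⟨0, fun _ h => hB _ h.1⟩ ⟨s, hs, hy2⟩ fun _ h => ⟨h.1, hy.trans h.2⟩

/-- An envelope formula valid on an arbitrary set of types, with gaps or atoms. The conjugate `κ(y)
= sup (s' y - U s')` grows at rate at most `leastType B X y`: at level `y` no type above one with
allocation at least `y` does better in the supremum, by incentive compatibility. -/
theorem payment_le_integral (hB : ∀ s ∈ B, 0 ≤ s) (hX : ∀ s ∈ B, 0 ≤ X s)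
    (hU : ∀ s ∈ B, 0 ≤ U s) (hic : ∀ s ∈ B, ∀ s' ∈ B, U s + (s' - s) * X s ≤ U s')
    {s : ℝ} (hs : s ∈ B) :
    s * X s - U s ≤ ∫ y in (0 : ℝ)..X s, leastType B X y := by
  -- Only types up to `s` compete, so the supremum is bounded even when `B` is not.
  set κ : ℝ → ℝ := fun y => sSup ((fun s' => s' * y - U s') '' (B ∩ Set.Iic s)) with hκ
  have hne : (B ∩ Set.Iic s).Nonempty := ⟨s, hs, Set.self_mem_Iic⟩
  have hbdd : ∀ y, 0 ≤ y → BddAbove ((fun s' => s' * y - U s') '' (B ∩ Set.Iic s)) := by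
    rintro y hy
    refine ⟨s * y, ?_⟩
    rintro _ ⟨s', ⟨hs', hle⟩, rfl⟩
    have := mul_le_mul_of_nonneg_right (Set.mem_Iic.mp hle) hy
    have := hU s' hs'
    simp only
    linarith
  have hmem : ∀ y, 0 ≤ y → ∀ s' ∈ B, s' ≤ s → s' * y - U s' ≤ κ y := fun y hy s' h1 h2 =>
    le_csSup (hbdd y hy) ⟨s', ⟨h1, h2⟩, rfl⟩
  have hmono := leastType_monotoneOn (X := X) hB hs
  have hint : ∀ x y, 0 ≤ x → x ≤ y → y ≤ X s →
      IntervalIntegrable (leastType B X) volume x y := fun x y _ hxy hy =>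
    (hmono.mono (by rw [Set.uIcc_of_le hxy]; exact fun z hz => hz.2.trans hy)).intervalIntegrable
  have hstep : ∀ y1 y2, 0 ≤ y1 → y1 ≤ y2 → y2 ≤ X s →
      κ y2 - κ y1 ≤ (y2 - y1) * leastType B X y2 := by
    intro y1 y2 h1 h12 h2
    have hcand : ∀ s2 ∈ B, y2 ≤ X s2 → s2 ≤ s → κ y2 ≤ κ y1 + (y2 - y1) * s2 := by
      intro s2 hs2 hy2 hle
      refine csSup_le (hne.image _) ?_
      rintro _ ⟨s', ⟨hs', hs's⟩, rfl⟩
      simp only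
      rcases le_total s' s2 with hlt | hlt
      · have := hmem y1 h1 s' hs' hs's
        nlinarith
      · have := hmem y1 h1 s2 hs2 hle
        have := hic s2 hs2 s' hs'
        nlinarith
    have hcand' : ∀ s2 ∈ B, y2 ≤ X s2 → κ y2 - κ y1 ≤ (y2 - y1) * s2 := by
      intro s2 hs2 hy2
      rcases le_total s2 s with hle | hle
      · linarith [hcand s2 hs2 hy2 hle]
      · have := hcand s hs h2 le_rfl
        nlinarith
    rcases h12.eq_or_lt with rfl | hlt
    · simp
    · have hpos : 0 < y2 - y1 := by linarith
      rw [← div_le_iff₀' hpos]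
      refine le_csInf ⟨s, hs, h2⟩ ?_
      rintro s2 ⟨hs2, hy2⟩
      rw [div_le_iff₀' hpos]
      exact hcand' s2 hs2 hy2
  -- The increment of `κ` is controlled by `leastType` at the right endpoint, that of its integral
  -- by the left endpoint. The discrepancy has exactly the form that vanishes under refinement.
  have hF := le_of_sub_le_mul_sub (F := fun y => κ y - ∫ z in (0 : ℝ)..y, leastType B X z)
    (Θ := leastType B X) (hX s hs) (by
      intro x y hx hxy hy
      have h1 := hstep x y hx hxy hy
      have h2 : (∫ z in (0 : ℝ)..y, leastType B X z) - ∫ z in (0 : ℝ)..x, leastType B X z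
          = ∫ z in x..y, leastType B X z := by
        rw [intervalIntegral.integral_interval_sub_left (hint 0 y le_rfl (hx.trans hxy) hy)
          (hint 0 x le_rfl hx (hxy.trans hy))]
      have h3 : (y - x) * leastType B X x ≤ ∫ z in x..y, leastType B X z := by
        have := intervalIntegral.integral_mono_on hxy intervalIntegrable_const (hint x y hx hxy hy)
          (f := fun _ => leastType B X x)
          (fun z hz => hmono (hxy.trans hy) (hz.2.trans hy) hz.1)
        simpa using this
      nlinarith)
  have h0 : κ 0 ≤ 0 := by
    refine csSup_le (hne.image _) ?_
    rintro _ ⟨s', ⟨hs', -⟩, rfl⟩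
    have := hU s' hs'
    simp only
    linarith
  have := hmem (X s) (hX s hs) s hs le_rfl
  simp only [intervalIntegral.integral_same] at hF
  linarith

end SingleItem

/-! ### The quantile function -/

section Quantile

variable {μ : Measure ℝ} [IsProbabilityMeasure μ]

theorem tail_antitone (μ : Measure ℝ) [IsFiniteMeasure μ] :
    Antitone fun v : ℝ => μ.real (Set.Ici v) := fun _ _ h =>
  measureReal_mono (Set.Ici_subset_Ici.mpr h)

theorem tail_le_one (v : ℝ) : μ.real (Set.Ici v) ≤ 1 := measureReal_le_one

theorem tendsto_tail_atTop : Tendsto (fun v : ℝ => μ.real (Set.Ici v)) atTop (𝓝 0) := by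
  have h := tendsto_measure_iInter_atTop (μ := μ) (s := fun v : ℝ => Set.Ici v)
    (fun _ => measurableSet_Ici.nullMeasurableSet) (fun _ _ h => Set.Ici_subset_Ici.mpr h)
    ⟨0, measure_ne_top _ _⟩
  have he : ⋂ v : ℝ, Set.Ici v = ∅ := by
    ext x
    simp only [Set.mem_iInter, Set.mem_Ici, Set.mem_empty_iff_false, iff_false, not_forall, not_le]
    exact ⟨x + 1, by linarith⟩
  rw [he, measure_empty] at h
  exact (ENNReal.tendsto_toReal_zero_iff (fun _ => measure_ne_top _ _)).mpr h

theorem tendsto_tail_atBot : Tendsto (fun v : ℝ => μ.real (Set.Ici v)) atBot (𝓝 1) := by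
  have h := tendsto_measure_iUnion_atBot (μ := μ) (s := fun v : ℝ => Set.Ici v)
    (fun _ _ h => Set.Ici_subset_Ici.mpr h)
  have he : ⋃ v : ℝ, Set.Ici v = Set.univ := by
    ext x
    simp only [Set.mem_iUnion, Set.mem_Ici, Set.mem_univ, iff_true]
    exact ⟨x, le_rfl⟩
  rw [he, measure_univ] at h
  exact (ENNReal.tendsto_toReal ENNReal.one_ne_top).comp h

/-- The tail probability is left-continuous. -/
theorem le_tail_of_forall_lt {q v : ℝ} (h : ∀ w < v, q ≤ μ.real (Set.Ici w)) :
    q ≤ μ.real (Set.Ici v) := by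
  have hlim : Tendsto (fun n : ℕ => μ (Set.Ici (v - 1 / ((n : ℝ) + 1)))) atTop
      (𝓝 (μ (⋂ n : ℕ, Set.Ici (v - 1 / ((n : ℝ) + 1))))) := by
    refine tendsto_measure_iInter_atTop (fun _ => measurableSet_Ici.nullMeasurableSet) ?_
      ⟨0, measure_ne_top _ _⟩
    intro m n hmn
    refine Set.Ici_subset_Ici.mpr ?_
    have := one_div_le_one_div_of_le (by positivity : (0 : ℝ) < (m : ℝ) + 1)
      (by exact_mod_cast Nat.succ_le_succ hmn : (m : ℝ) + 1 ≤ (n : ℝ) + 1)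
    linarith
  have he : ⋂ n : ℕ, Set.Ici (v - 1 / ((n : ℝ) + 1)) = Set.Ici v := by
    ext x
    simp only [Set.mem_iInter, Set.mem_Ici]
    refine ⟨fun hx => ?_, fun hx n => ?_⟩
    · refine le_of_forall_pos_sub_le fun ε hε => ?_
      obtain ⟨n, hn⟩ := exists_nat_one_div_lt hε
      linarith [hx n]
    · have : (0 : ℝ) < 1 / ((n : ℝ) + 1) := by positivity
      linarith
  rw [he] at hlim
  refine ge_of_tendsto' ((ENNReal.tendsto_toReal (measure_ne_top _ _)).comp hlim) fun n => h _ ?_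
  have : (0 : ℝ) < 1 / ((n : ℝ) + 1) := by positivity
  linarith

theorem priceAt_set_bddAbove {q : ℝ} (hq : 0 < q) : BddAbove {v : ℝ | q ≤ μ.real (Set.Ici v)} := by
  obtain ⟨v, hv⟩ := ((tendsto_tail_atTop (μ := μ)).eventually_lt_const hq).exists
  refine ⟨v, fun w hw => ?_⟩
  by_contra hlt
  exact absurd (hw.trans (tail_antitone μ (not_le.mp hlt).le)) (not_le.mpr hv)

theorem priceAt_set_nonempty {q : ℝ} (hq : q < 1) : {v : ℝ | q ≤ μ.real (Set.Ici v)}.Nonempty := by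
  obtain ⟨v, hv⟩ := ((tendsto_tail_atBot (μ := μ)).eventually_const_lt hq).exists
  exact ⟨v, hv.le⟩

theorem le_priceAt {q v : ℝ} (hq : 0 < q) (h : q ≤ μ.real (Set.Ici v)) : v ≤ priceAt μ q :=
  le_csSup (priceAt_set_bddAbove hq) h

theorem le_tail_priceAt {q : ℝ} (hne : {v : ℝ | q ≤ μ.real (Set.Ici v)}.Nonempty) :
    q ≤ μ.real (Set.Ici (priceAt μ q)) := by
  refine le_tail_of_forall_lt fun w hw => ?_
  obtain ⟨v, hv, hwv⟩ := exists_lt_of_lt_csSup hne hw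
  exact hv.trans (tail_antitone μ hwv.le)

/-- A Galois connection between quantiles and prices: left-continuity of the tail makes the supremum
in `priceAt` attained. At `q ≤ 0` the set is all of `ℝ` and `sSup` takes its default value `0`,
hence the open interval. -/
theorem le_priceAt_iff {q v : ℝ} (hq : q ∈ Set.Ioo (0 : ℝ) 1) :
    v ≤ priceAt μ q ↔ q ≤ μ.real (Set.Ici v) :=
  ⟨fun h => (le_tail_priceAt (priceAt_set_nonempty hq.2)).trans (tail_antitone μ h),
    le_priceAt hq.1⟩

theorem priceAt_antitoneOn (μ : Measure ℝ) [IsProbabilityMeasure μ] :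
    AntitoneOn (priceAt μ) (Set.Ioo 0 1) := fun _ hx _ hy hxy =>
  (le_priceAt_iff hx).mpr (hxy.trans ((le_priceAt_iff hy).mp le_rfl))

theorem aemeasurable_priceAt : AEMeasurable (priceAt μ) (volume.restrict (Set.Ioo 0 1)) :=
  aemeasurable_restrict_of_antitoneOn measurableSet_Ioo (priceAt_antitoneOn μ)

/-- The quantile function maps the uniform distribution to `μ`. -/
theorem map_priceAt : (volume.restrict (Set.Ioo (0 : ℝ) 1)).map (priceAt μ) = μ := by
  have : IsProbabilityMeasure (volume.restrict (Set.Ioo (0 : ℝ) 1)) := ⟨by simp⟩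
  have := Measure.isProbabilityMeasure_map (aemeasurable_priceAt (μ := μ))
  refine Measure.ext_of_Ici _ _ fun v => ?_
  rw [Measure.map_apply_of_aemeasurable aemeasurable_priceAt measurableSet_Ici,
    Measure.restrict_apply' measurableSet_Ioo]
  have h1 : priceAt μ ⁻¹' Set.Ici v ∩ Set.Ioo 0 1
      = {q | q ∈ Set.Ioo (0 : ℝ) 1 ∧ q ≤ μ.real (Set.Ici v)} := by
    ext q
    simp only [Set.mem_inter_iff, Set.mem_preimage, Set.mem_Ici, Set.mem_ofPred_eq]
    exact ⟨fun h => ⟨h.2, (le_priceAt_iff h.2).mp h.1⟩, fun h => ⟨(le_priceAt_iff h.1).mpr h.2, h.1⟩⟩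
  have h2 : Set.Ioo 0 (μ.real (Set.Ici v)) ⊆ priceAt μ ⁻¹' Set.Ici v ∩ Set.Ioo 0 1 := by
    rw [h1]
    exact fun q hq => ⟨⟨hq.1, hq.2.trans_le (tail_le_one v)⟩, hq.2.le⟩
  have h3 : priceAt μ ⁻¹' Set.Ici v ∩ Set.Ioo 0 1 ⊆ Set.Ioc 0 (μ.real (Set.Ici v)) := by
    rw [h1]
    exact fun q hq => ⟨hq.1.1, hq.2⟩
  refine le_antisymm ((measure_mono h3).trans ?_) (le_trans ?_ (measure_mono h2)) <;>
    simp

/-- The increasing quantile function. -/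
def costAt (μ : Measure ℝ) (y : ℝ) : ℝ := priceAt μ (1 - y)

theorem one_sub_measurePreserving : MeasurePreserving (fun y : ℝ => 1 - y)
    (volume.restrict (Set.Ioo (0 : ℝ) 1)) (volume.restrict (Set.Ioo (0 : ℝ) 1)) := by
  have h := (Measure.measurePreserving_sub_left (volume : Measure ℝ) 1).restrict_preimage
    (measurableSet_Ioo (a := (0 : ℝ)) (b := 1))
  have he : (fun y : ℝ => 1 - y) ⁻¹' Set.Ioo 0 1 = Set.Ioo 0 1 := by
    ext y
    simp only [Set.mem_preimage, Set.mem_Ioo]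
    constructor <;> rintro ⟨h1, h2⟩ <;> constructor <;> linarith
  rwa [he] at h

theorem costAt_monotoneOn (μ : Measure ℝ) [IsProbabilityMeasure μ] :
    MonotoneOn (costAt μ) (Set.Ioo 0 1) := fun x hx y hy hxy =>
  priceAt_antitoneOn μ ⟨by linarith [hy.2], by linarith [hy.1]⟩
    ⟨by linarith [hx.2], by linarith [hx.1]⟩ (by linarith)

theorem aemeasurable_costAt : AEMeasurable (costAt μ) (volume.restrict (Set.Ioo 0 1)) :=
  aemeasurable_restrict_of_monotoneOn measurableSet_Ioo (costAt_monotoneOn μ)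

theorem map_costAt : (volume.restrict (Set.Ioo (0 : ℝ) 1)).map (costAt μ) = μ := by
  have h := map_priceAt (μ := μ)
  conv_lhs at h => rw [← one_sub_measurePreserving.map_eq]
  rwa [AEMeasurable.map_map_of_aemeasurable (by
    rw [one_sub_measurePreserving.map_eq]; exact aemeasurable_priceAt)
    one_sub_measurePreserving.aemeasurable] at h

theorem costAt_nonneg (hμ : ∀ᵐ x ∂μ, 0 ≤ x) {y : ℝ} (hy : y ∈ Set.Ioo (0 : ℝ) 1) :
    0 ≤ costAt μ y := by
  refine le_priceAt (by linarith [hy.2]) ?_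
  have : μ.real (Set.Ici 0) = 1 := by
    have h : μ (Set.Ici 0) = 1 := (mem_ae_iff_prob_eq_one measurableSet_Ici).mp hμ
    simp [measureReal_def, h]
  linarith [hy.1]

end Quantile

/-! ### Integrals of positive parts -/

section PosPart

variable {Ω : Type*} [MeasurableSpace Ω] {P : Measure Ω} {f : Ω → ℝ}

theorem ofReal_integral_le_lintegral_ofReal :
    ENNReal.ofReal (∫ ω, f ω ∂P) ≤ ∫⁻ ω, ENNReal.ofReal (f ω) ∂P := by
  by_cases hf : Integrable f P
  · rw [integral_eq_lintegral_pos_part_sub_lintegral_neg_part hf]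
    refine (ENNReal.ofReal_le_ofReal (sub_le_self _ ENNReal.toReal_nonneg)).trans ?_
    exact ENNReal.ofReal_toReal_le
  · simp [integral_undef hf]

/-- Additive form of `∫ f = ∫ f⁺ - ∫ f⁻`, so that profit bounds in `ℝ≥0∞` need no subtraction of
infinities. -/
theorem lintegral_ofReal_le_add (hf : Integrable f P) :
    ∫⁻ ω, ENNReal.ofReal (f ω) ∂P
      ≤ ∫⁻ ω, ENNReal.ofReal (-f ω) ∂P + ENNReal.ofReal (∫ ω, f ω ∂P) := by
  have hA : ∫⁻ ω, ENNReal.ofReal (f ω) ∂P ≠ ⊤ := hf.lintegral_lt_top.ne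
  have hB : ∫⁻ ω, ENNReal.ofReal (-f ω) ∂P ≠ ⊤ := hf.neg.lintegral_lt_top.ne
  rw [integral_eq_lintegral_pos_part_sub_lintegral_neg_part hf]
  rw [ENNReal.ofReal_sub _ ENNReal.toReal_nonneg, ENNReal.ofReal_toReal hA,
    ENNReal.ofReal_toReal hB]
  exact le_add_tsub

theorem integrable_of_lintegral_ofReal (hm : AEStronglyMeasurable f P)
    (h1 : ∫⁻ ω, ENNReal.ofReal (f ω) ∂P ≠ ⊤) (h2 : ∫⁻ ω, ENNReal.ofReal (-f ω) ∂P ≠ ⊤) :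
    Integrable f P := by
  refine ⟨hm, ?_⟩
  rw [hasFiniteIntegral_iff_norm]
  have : ∀ ω, ENNReal.ofReal ‖f ω‖ ≤ ENNReal.ofReal (f ω) + ENNReal.ofReal (-f ω) := by
    intro ω
    rcases le_total 0 (f ω) with h | h
    · rw [Real.norm_of_nonneg h]; exact le_self_add
    · rw [Real.norm_of_nonpos h]; exact le_add_self
  refine (lintegral_mono this).trans_lt ?_
  rw [lintegral_add_left' hm.aemeasurable.ennreal_ofReal]
  exact ENNReal.add_lt_top.mpr ⟨h1.lt_top, h2.lt_top⟩

end PosPart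

/-! ### The single-item bound -/

/-- The maximal expected profit from posting a price for an item of cost `c` to a buyer whose value
has distribution `μ`. -/
def postedProfit (μ : Measure ℝ) (c : ℝ) : ℝ≥0∞ :=
  ⨆ p : ℝ, ENNReal.ofReal (p - c) * μ (Set.Ici p)

/-- The expectation of `postedProfit μ` when the cost has distribution `ν`. -/
def singleProfit (μ ν : Measure ℝ) : ℝ≥0∞ := ∫⁻ c, postedProfit μ c ∂ν

theorem postedProfit_antitone (μ : Measure ℝ) : Antitone (postedProfit μ) := fun _ _ h =>
  iSup_mono fun _ => by gcongr

theorem measurable_postedProfit (μ : Measure ℝ) : Measurable (postedProfit μ) :=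
  (postedProfit_antitone μ).measurable

/-! ### Cost of an allocation: the rearrangement bound. -/

section Bathtub

variable {Ω : Type*} [MeasurableSpace Ω] {P : Measure Ω} [IsProbabilityMeasure P] {k ξ : Ω → ℝ}

/-- Among all allocations of a given probability, serving the lowest costs is cheapest. -/
theorem integral_costAt_le (hk : Measurable k) (hk0 : ∀ᵐ ω ∂P, 0 ≤ k ω) (hξ : Measurable ξ)
    (hξ01 : ∀ ω, ξ ω ∈ Set.Icc (0 : ℝ) 1) (hint : Integrable (fun ω => k ω * ξ ω) P) :
    IntegrableOn (costAt (P.map k)) (Set.Ioo 0 (∫ ω, ξ ω ∂P)) ∧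
      ∫ y in Set.Ioo 0 (∫ ω, ξ ω ∂P), costAt (P.map k) y ≤ ∫ ω, k ω * ξ ω ∂P := by
  have hν : IsProbabilityMeasure (P.map k) := Measure.isProbabilityMeasure_map hk.aemeasurable
  set ν := P.map k with hνdef
  have hν0 : ∀ᵐ x ∂ν, 0 ≤ x := (ae_map_iff hk.aemeasurable measurableSet_Ici).mpr hk0
  have hξint : Integrable ξ P := Integrable.of_bound hξ.aestronglyMeasurable 1
    (ae_of_all _ fun ω => by rw [Real.norm_of_nonneg (hξ01 ω).1]; exact (hξ01 ω).2)
  set X := ∫ ω, ξ ω ∂P with hX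
  have hX0 : 0 ≤ X := integral_nonneg fun ω => (hξ01 ω).1
  have hX1 : X ≤ 1 := by
    have := integral_mono hξint (integrable_const (1 : ℝ)) fun ω => (hξ01 ω).2
    simpa using this
  rcases hX0.eq_or_lt with h0 | hXpos
  · rw [← h0]
    simp only [Set.Ioo_self, integrableOn_empty, setIntegral_empty, true_and]
    refine integral_nonneg_of_ae ?_
    filter_upwards [hk0] with ω hω using mul_nonneg hω (hξ01 ω).1
  rcases hX1.eq_or_lt with h1 | hXlt
  -- Full allocation is separate: costs may be unbounded and `costAt` at `1` is only a default
  -- value, so there is no threshold cost. Both sides are then the mean cost.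
  · have hae : ξ =ᵐ[P] fun _ => 1 := by
      have h2 : ∫ ω, (1 - ξ ω) ∂P = 0 := by
        rw [integral_sub (integrable_const _) hξint, ← hX, h1]
        simp
      have h3 := (integral_eq_zero_iff_of_nonneg (fun ω => sub_nonneg.mpr (hξ01 ω).2)
        ((integrable_const _).sub hξint)).mp h2
      filter_upwards [h3] with ω hω
      have : 1 - ξ ω = 0 := hω
      linarith
    have hk1 : (fun ω => k ω * ξ ω) =ᵐ[P] k := by
      filter_upwards [hae] with ω hω
      rw [hω, mul_one]
    rw [integral_congr_ae hk1]
    have hkint : Integrable k P := hint.congr hk1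
    have hid : Integrable (fun x : ℝ => x) ν :=
      (integrable_map_measure aestronglyMeasurable_id hk.aemeasurable).mpr hkint
    have hmap := map_costAt (μ := ν)
    have hc : Integrable (costAt ν) (volume.restrict (Set.Ioo 0 1)) := by
      rw [← hmap] at hid
      exact (integrable_map_measure aestronglyMeasurable_id aemeasurable_costAt).mp hid
    rw [h1]
    refine ⟨hc, le_of_eq ?_⟩
    have e1 : ∫ x, x ∂ν = ∫ ω, k ω ∂P :=
      integral_map (f := fun x : ℝ => x) hk.aemeasurable aestronglyMeasurable_id
    rw [← e1]
    conv_rhs => rw [← hmap]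
    exact (integral_map (f := fun x : ℝ => x) aemeasurable_costAt aestronglyMeasurable_id).symm
  -- Threshold argument: `(z - k) ξ ≤ (z - k)⁺` pointwise, and since the costs below `z` are served
  -- first, `E (z - k)⁺` is the integral of `z - costAt ν` over `(0, X)`. The terms `z X` cancel.
  · set z := costAt ν X with hz
    have hXm : X ∈ Set.Ioo (0 : ℝ) 1 := ⟨hXpos, hXlt⟩
    have hsub : Set.Ioo 0 X ⊆ Set.Ioo (0 : ℝ) 1 := Set.Ioo_subset_Ioo_right hX1
    have hlow : ∀ y ∈ Set.Ioo 0 X, costAt ν y ≤ z := fun y hy =>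
      costAt_monotoneOn ν (hsub hy) hXm hy.2.le
    have hc : IntegrableOn (costAt ν) (Set.Ioo 0 X) := by
      refine Integrable.of_bound
        ((aemeasurable_costAt (μ := ν)).mono_set hsub).aestronglyMeasurable z ?_
      filter_upwards [ae_restrict_mem measurableSet_Ioo] with y hy
      rw [Real.norm_of_nonneg (costAt_nonneg hν0 (hsub hy))]
      exact hlow y hy
    refine ⟨hc, ?_⟩
    have hz0 : 0 ≤ z := costAt_nonneg hν0 hXm
    have hm : Measurable fun x : ℝ => max (z - x) 0 := by fun_prop
    have e1 : ∫ ω, max (z - k ω) 0 ∂P = ∫ y in Set.Ioo 0 1, max (z - costAt ν y) 0 := by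
      rw [← integral_map (f := fun x : ℝ => max (z - x) 0) hk.aemeasurable hm.aestronglyMeasurable,
        ← hνdef]
      conv_lhs => rw [← map_costAt (μ := ν)]
      exact integral_map aemeasurable_costAt hm.aestronglyMeasurable
    have e2 : ∫ y in Set.Ioo 0 1, max (z - costAt ν y) 0 = ∫ y in Set.Ioo 0 X, (z - costAt ν y) := by
      rw [setIntegral_eq_of_subset_of_forall_sdiff_eq_zero measurableSet_Ioo hsub]
      · refine setIntegral_congr_fun measurableSet_Ioo fun y hy => ?_
        exact max_eq_left (sub_nonneg.mpr (hlow y hy))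
      · rintro y ⟨hy, hy'⟩
        have hXy : X ≤ y := by
          by_contra hlt
          exact hy' ⟨hy.1, not_le.mp hlt⟩
        exact max_eq_right (sub_nonpos.mpr (costAt_monotoneOn ν hXm hy hXy))
    have e3 : ∫ y in Set.Ioo 0 X, (z - costAt ν y) = z * X - ∫ y in Set.Ioo 0 X, costAt ν y := by
      rw [integral_sub (integrable_const _) hc]
      simp [hX0, mul_comm]
    have hmaxint : Integrable (fun ω => max (z - k ω) 0) P := by
      refine Integrable.of_bound (by fun_prop) z ?_
      filter_upwards [hk0] with ω hω
      rw [Real.norm_of_nonneg (le_max_right _ _)]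
      exact max_le (by linarith) hz0
    have e4 : ∫ ω, (z * ξ ω - k ω * ξ ω) ∂P ≤ ∫ ω, max (z - k ω) 0 ∂P := by
      refine integral_mono ((hξint.const_mul z).sub hint) hmaxint fun ω => ?_
      have h1 := hξ01 ω
      have h2 : (z - k ω) ≤ max (z - k ω) 0 := le_max_left _ _
      have h3 : 0 ≤ max (z - k ω) 0 := le_max_right _ _
      simp only
      nlinarith [mul_le_mul_of_nonneg_right h2 h1.1, h1.2]
    rw [integral_sub (hξint.const_mul z) hint, integral_const_mul, ← hX] at e4
    linarith

end Bathtub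

section SingleItem

variable {Ω : Type*} [MeasurableSpace Ω] {P : Measure Ω} [IsProbabilityMeasure P]
  {μ : Measure ℝ} [IsProbabilityMeasure μ] {B : Set ℝ} {k : Ω → ℝ} {ξ : ℝ → Ω → ℝ} {U : ℝ → ℝ}

/-- Off the order-connected set of levels reached by some type, the infimum is over the empty set
and equals `0`. On that set the function is monotone. -/
theorem aemeasurable_leastType (hB0 : ∀ s ∈ B, 0 ≤ s) (X : ℝ → ℝ) (ν : Measure ℝ) :
    AEMeasurable (leastType B X) ν := by
  set Y : Set ℝ := {y | ∃ s ∈ B, y ≤ X s} with hY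
  have hYm : MeasurableSet Y := by
    have : Y.OrdConnected := by
      refine ⟨fun x _ y hy z hz => ?_⟩
      obtain ⟨s, hs, hle⟩ := hy
      exact ⟨s, hs, hz.2.trans hle⟩
    exact this.measurableSet
  have hmono : MonotoneOn (leastType B X) Y := by
    rintro x _ y ⟨s, hs, hy⟩ hxy
    exact leastType_monotoneOn hB0 hs (hxy.trans hy) hy hxy
  have hind : Y.indicator (leastType B X) = leastType B X := by
    refine Set.indicator_eq_self.mpr fun y hy => ?_
    by_contra hcon
    refine hy ?_
    have : {s | s ∈ B ∧ y ≤ X s} = ∅ := by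
      ext s
      simp only [Set.mem_ofPred_eq, Set.mem_empty_iff_false, iff_false]
      exact fun h => hcon ⟨s, h⟩
    rw [leastType, this, Real.sInf_empty]
  rw [← hind]
  exact (aemeasurable_indicator_iff hYm).mpr (aemeasurable_restrict_of_monotoneOn hYm hmono)

/-- A single-item mechanism that is incentive compatible and individually rational on the set `B` of
types earns at most the expected posted-price profit. -/
theorem lintegral_surplus_le (hBm : MeasurableSet B) (hB0 : ∀ s ∈ B, 0 ≤ s) (hk : Measurable k)
    (hk0 : ∀ᵐ ω ∂P, 0 ≤ k ω) (hξ : Measurable (Function.uncurry ξ))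
    (hξ01 : ∀ s ω, ξ s ω ∈ Set.Icc (0 : ℝ) 1) (hU : ∀ s ∈ B, 0 ≤ U s)
    (hic : ∀ s ∈ B, ∀ s' ∈ B, U s + (s' - s) * ∫ ω, ξ s ω ∂P ≤ U s') :
    ∫⁻ s in B, ENNReal.ofReal (∫ ω, (s - k ω) * ξ s ω ∂P - U s) ∂μ
      ≤ singleProfit μ (P.map k) := by
  have hν : IsProbabilityMeasure (P.map k) := Measure.isProbabilityMeasure_map hk.aemeasurable
  set X : ℝ → ℝ := fun s => ∫ ω, ξ s ω ∂P with hXdef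
  have hξm : ∀ s, Measurable (ξ s) := fun s => hξ.of_uncurry_left
  have hξint : ∀ s, Integrable (ξ s) P := fun s =>
    Integrable.of_bound (hξm s).aestronglyMeasurable 1
      (ae_of_all _ fun ω => by rw [Real.norm_of_nonneg (hξ01 s ω).1]; exact (hξ01 s ω).2)
  have hX0 : ∀ s, 0 ≤ X s := fun s => integral_nonneg fun ω => (hξ01 s ω).1
  have hX1 : ∀ s, X s ≤ 1 := fun s => by
    have := integral_mono (hξint s) (integrable_const (1 : ℝ)) fun ω => (hξ01 s ω).2
    simpa using this
  have hXm : Measurable X := hξ.stronglyMeasurable.integral_prod_right.measurable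
  set θ := leastType B X with hθ
  set γ := costAt (P.map k) with hγ
  -- Subtracting the cost bound from the payment bound, then replacing `θ - γ` by its positive part
  -- on the region `y ≤ X s`, so that Tonelli applies below.
  have hpt : ∀ s ∈ B, ENNReal.ofReal (∫ ω, (s - k ω) * ξ s ω ∂P - U s) ≤
      ∫⁻ y in Set.Ioo (0 : ℝ) 1,
        {z : ℝ × ℝ | z.2 ≤ X z.1}.indicator (fun z => ENNReal.ofReal (θ z.2 - γ z.2)) (s, y) := by
    intro s hs
    by_cases hint : Integrable (fun ω => k ω * ξ s ω) P
    · have e1 : ∫ ω, (s - k ω) * ξ s ω ∂P = s * X s - ∫ ω, k ω * ξ s ω ∂P := by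
        simp_rw [sub_mul]
        rw [integral_sub ((hξint s).const_mul s) hint, integral_const_mul]
      obtain ⟨hc, hle⟩ := integral_costAt_le hk hk0 (hξm s) (hξ01 s) hint
      have hpay := payment_le_integral hB0 (fun s _ => hX0 s) hU hic hs
      rw [intervalIntegral.integral_of_le (hX0 s), integral_Ioc_eq_integral_Ioo] at hpay
      have hθint : IntegrableOn θ (Set.Ioo 0 (X s)) := by
        refine ((leastType_monotoneOn hB0 hs).mono ?_).integrableOn_isCompact
          (isCompact_Icc (a := 0) (b := X s)) |>.mono_set Set.Ioo_subset_Icc_self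
        exact fun y hy => hy.2
      have e2 : ∫ ω, (s - k ω) * ξ s ω ∂P - U s ≤ ∫ y in Set.Ioo 0 (X s), (θ y - γ y) := by
        rw [e1, integral_sub hθint hc]
        linarith
      refine (ENNReal.ofReal_le_ofReal e2).trans (ofReal_integral_le_lintegral_ofReal.trans ?_)
      rw [← lintegral_indicator measurableSet_Ioo, ← lintegral_indicator measurableSet_Ioo]
      refine lintegral_mono fun y => ?_
      by_cases hy : y ∈ Set.Ioo 0 (X s)
      · have hy1 : y ∈ Set.Ioo (0 : ℝ) 1 := ⟨hy.1, hy.2.trans_le (hX1 s)⟩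
        have hy2 : ((s, y) : ℝ × ℝ) ∈ {z : ℝ × ℝ | z.2 ≤ X z.1} := hy.2.le
        rw [Set.indicator_of_mem hy, Set.indicator_of_mem hy1, Set.indicator_of_mem hy2]
      · rw [Set.indicator_of_notMem hy]
        exact zero_le
    -- With infinite expected cost the Bochner integral is `0` by convention; `U s ≥ 0` then makes
    -- the left-hand side vanish.
    · have : ∫ ω, (s - k ω) * ξ s ω ∂P = 0 := by
        refine integral_undef fun hcon => hint ?_
        have := ((hξint s).const_mul s).sub hcon
        refine this.congr (ae_of_all _ fun ω => ?_)
        simp only [Pi.sub_apply]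
        ring
      rw [this, ENNReal.ofReal_of_nonpos (by linarith [hU s hs])]
      exact zero_le
  refine (setLIntegral_mono' hBm hpt).trans ?_
  have hθm : AEMeasurable θ (volume.restrict (Set.Ioo (0 : ℝ) 1)) :=
    aemeasurable_leastType hB0 X _
  have hγm : AEMeasurable γ (volume.restrict (Set.Ioo (0 : ℝ) 1)) := aemeasurable_costAt
  rw [lintegral_lintegral_swap]
  swap
  · have hset : MeasurableSet {z : ℝ × ℝ | z.2 ≤ X z.1} :=
      measurableSet_le measurable_snd (hXm.comp measurable_fst)
    refine AEMeasurable.indicator ?_ hset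
    exact ((hθm.sub hγm).comp_snd).ennreal_ofReal
  -- At a fixed level `y`, the types in `B` served at least `y` all lie in `[θ y, ∞)`, so `θ y` acts
  -- as a posted price against the cost `γ y`.
  have hy : ∀ y ∈ Set.Ioo (0 : ℝ) 1, ∫⁻ s in B,
      {z : ℝ × ℝ | z.2 ≤ X z.1}.indicator (fun z => ENNReal.ofReal (θ z.2 - γ z.2)) (s, y) ∂μ
        ≤ postedProfit μ (γ y) := by
    intro y _
    have hset : MeasurableSet {s | y ≤ X s} := measurableSet_le measurable_const hXm
    have : ∀ s, {z : ℝ × ℝ | z.2 ≤ X z.1}.indicator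
        (fun z => ENNReal.ofReal (θ z.2 - γ z.2)) (s, y)
          = {s | y ≤ X s}.indicator (fun _ => ENNReal.ofReal (θ y - γ y)) s := fun s => by
      simp [Set.indicator]
    simp_rw [this]
    rw [lintegral_indicator hset, setLIntegral_const, Measure.restrict_apply hset]
    refine le_trans ?_ (le_iSup (fun p : ℝ => ENNReal.ofReal (p - γ y) * μ (Set.Ici p)) (θ y))
    gcongr
    rintro s ⟨hs1, hs2⟩
    exact leastType_le hB0 hs2 hs1
  refine (setLIntegral_mono' measurableSet_Ioo hy).trans (le_of_eq ?_)
  rw [singleProfit]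
  conv_rhs => rw [← map_costAt (μ := P.map k)]
  exact (lintegral_map' (measurable_postedProfit μ).aemeasurable aemeasurable_costAt).symm

end SingleItem

section


/-! ### The upper bound on the optimal profit -/

theorem support_nonneg {μ : Measure ℝ} (hμ : ∀ᵐ x ∂μ, 0 ≤ x) {s : ℝ} (hs : s ∈ μ.support) :
    0 ≤ s :=
  Measure.support_subset_of_isClosed isClosed_Ici hμ hs

variable {ι : Type*} [Fintype ι]

section TypeSpace

variable {D : ι → Measure ℝ}

theorem measurableSet_typeSpace (D : ι → Measure ℝ) : MeasurableSet (typeSpace D) := by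
  have : typeSpace D = ⋂ j, (fun t : ι → ℝ => t j) ⁻¹' (D j).support := by
    ext t
    simp [typeSpace]
  rw [this]
  exact MeasurableSet.iInter fun j =>
    Measure.isClosed_support.measurableSet.preimage (measurable_pi_apply j)

theorem ae_mem_typeSpace [∀ j, IsProbabilityMeasure (D j)] :
    ∀ᵐ t ∂Measure.pi D, t ∈ typeSpace D := by
  have h : ∀ j, ∀ᵐ t : ι → ℝ ∂Measure.pi D, t j ∈ (D j).support := fun j =>
    Measure.tendsto_eval_ae_ae.eventually (Measure.support_mem_ae (μ := D j))
  exact ae_all_iff.mpr h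

end TypeSpace

section Permit

variable {C : Measure (ι → ℝ)} [IsProbabilityMeasure C]

theorem ae_nonneg_apply (hC : ∀ᵐ c ∂C, ∀ j, 0 ≤ c j) (j : ι) : ∀ᵐ c ∂C, 0 ≤ c j := by
  filter_upwards [hC] with c hc using hc j

theorem integrable_permit (hC : ∀ᵐ c ∂C, ∀ j, 0 ≤ c j) (j : ι) (x : ℝ) :
    Integrable (fun c : ι → ℝ => max (x - c j) 0) C := by
  refine Integrable.of_bound ((measurable_const.sub (measurable_pi_apply j)).max
    measurable_const).aestronglyMeasurable |x| ?_
  filter_upwards [hC] with c hc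
  rw [Real.norm_of_nonneg (le_max_right _ _)]
  exact max_le (by linarith [le_abs_self x, hc j]) (abs_nonneg x)

theorem permitValue_nonneg (j : ι) (x : ℝ) : 0 ≤ permitValue C j x :=
  integral_nonneg fun _ => le_max_right _ _

theorem permitValue_monotone (hC : ∀ᵐ c ∂C, ∀ j, 0 ≤ c j) (j : ι) :
    Monotone (permitValue C j) := fun x y h =>
  integral_mono (integrable_permit hC j x) (integrable_permit hC j y) fun c => by
    simp only
    gcongr

end Permit

/-- The expected permit value of item `k` on the event that some other item has a permit value which
is at least as large. -/
def overlap (D : ι → Measure ℝ) (C : Measure (ι → ℝ)) (k : ι) : ℝ≥0∞ :=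
  ∫⁻ t in {t : ι → ℝ | ∃ i, i ≠ k ∧ permitValue C k (t k) ≤ permitValue C i (t i)},
    ENNReal.ofReal (permitValue C k (t k)) ∂Measure.pi D

section Mechanism

variable {D : ι → Measure ℝ} {C : Measure (ι → ℝ)} [∀ j, IsProbabilityMeasure (D j)]
  [IsProbabilityMeasure C] {M : DirectMechanism ι}

/-- The profit of the seller in state `(t, c)`. -/
def DirectMechanism.gain (M : DirectMechanism ι) (t c : ι → ℝ) : ℝ :=
  M.pay t c - ∑ j, c j * M.alloc t c j

/-- The expected surplus generated by item `j`, minus the utility of the buyer. -/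
def itemSurplus (C : Measure (ι → ℝ)) (M : DirectMechanism ι) (j : ι) (t : ι → ℝ) : ℝ :=
  ∫ c, (t j - c j) * M.alloc t c j ∂C - interimUtility C M t t

namespace IsBICIR

theorem measurable_alloc_right (hM : IsBICIR D C M) (t : ι → ℝ) (j : ι) :
    Measurable fun c => M.alloc t c j :=
  (hM.measurable_alloc j).comp measurable_prodMk_left

theorem integrable_alloc (hM : IsBICIR D C M) (t : ι → ℝ) (j : ι) :
    Integrable (fun c => M.alloc t c j) C :=
  Integrable.of_bound (hM.measurable_alloc_right t j).aestronglyMeasurable 1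
    (ae_of_all _ fun c => by
      rw [Real.norm_of_nonneg (hM.alloc_mem t c j).1]; exact (hM.alloc_mem t c j).2)

theorem integrable_utility (hM : IsBICIR D C M) {t' : ι → ℝ} (ht' : t' ∈ typeSpace D)
    (t : ι → ℝ) : Integrable (fun c => (∑ j, t j * M.alloc t' c j) - M.pay t' c) C :=
  (integrable_finsetSum _ fun j _ => (hM.integrable_alloc t' j).const_mul (t j)).sub
    (hM.integrable_pay t' ht')

theorem measurable_gain (hM : IsBICIR D C M) :
    Measurable fun z : (ι → ℝ) × (ι → ℝ) => M.gain z.1 z.2 := by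
  refine hM.measurable_pay.sub (Finset.measurable_sum _ fun j _ => ?_)
  exact ((measurable_pi_apply j).comp measurable_snd).mul (hM.measurable_alloc j)

theorem measurable_itemSurplus (hM : IsBICIR D C M) (j : ι) :
    Measurable (itemSurplus C M j) := by
  have h1 : Measurable fun z : (ι → ℝ) × (ι → ℝ) => (z.1 j - z.2 j) * M.alloc z.1 z.2 j :=
    (((measurable_pi_apply j).comp measurable_fst).sub
      ((measurable_pi_apply j).comp measurable_snd)).mul (hM.measurable_alloc j)
  have h2 : Measurable fun z : (ι → ℝ) × (ι → ℝ) =>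
      (∑ j, z.1 j * M.alloc z.1 z.2 j) - M.pay z.1 z.2 :=
    (Finset.measurable_sum _ fun j _ =>
      ((measurable_pi_apply j).comp measurable_fst).mul (hM.measurable_alloc j)).sub
        hM.measurable_pay
  exact (h1.stronglyMeasurable.integral_prod_right'.measurable).sub
    (h2.stronglyMeasurable.integral_prod_right'.measurable)

/-- For a fixed report, utility is affine in the true value of item `j`, with slope the interim
allocation. This turns BIC along a coordinate line into the single-item inequality `U s + (s' - s) X
s ≤ U s'`. -/
theorem interimUtility_update [DecidableEq ι] (hM : IsBICIR D C M) {x : ι → ℝ} {j : ι} {s s' : ℝ}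
    (hs : Function.update x j s ∈ typeSpace D) :
    interimUtility C M (Function.update x j s') (Function.update x j s) =
      interimUtility C M (Function.update x j s) (Function.update x j s) +
        (s' - s) * ∫ c, M.alloc (Function.update x j s) c j ∂C := by
  rw [interimUtility, interimUtility, ← integral_const_mul,
    ← integral_add (hM.integrable_utility hs _) ((hM.integrable_alloc _ j).const_mul _)]
  refine integral_congr_ae (ae_of_all _ fun c => ?_)
  simp only
  have : ∀ v : ℝ, ∑ i, Function.update x j v i * M.alloc (Function.update x j s) c i
      = v * M.alloc (Function.update x j s) c j
        + ∑ i ∈ Finset.univ.erase j, x i * M.alloc (Function.update x j s) c i := by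
    intro v
    rw [← Finset.add_sum_erase _ _ (Finset.mem_univ j), Function.update_self]
    congr 1
    refine Finset.sum_congr rfl fun i hi => ?_
    rw [Function.update_of_ne (Finset.ne_of_mem_erase hi)]
  rw [this s', this s]
  ring

/-- With the other values frozen, the item-`j` allocation and the buyer's whole utility satisfy the
hypotheses of `lintegral_surplus_le`. Payments need not split by item: only the incentive inequality
in coordinate `j` and `U ≥ 0` enter. The `j`-marginal bound is then integrated over the frozen
coordinates. -/
theorem lintegral_itemSurplus_le (hM : IsBICIR D C M) (hD : ∀ j, ∀ᵐ x ∂(D j), 0 ≤ x)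
    (hC : ∀ᵐ c ∂C, ∀ j, 0 ≤ c j) (j : ι) :
    ∫⁻ t, ENNReal.ofReal (itemSurplus C M j t) ∂Measure.pi D
      ≤ singleProfit (D j) (C.map fun c => c j) := by
  classical
  set f : (ι → ℝ) → ℝ≥0∞ :=
    (typeSpace D).indicator fun t => ENNReal.ofReal (itemSurplus C M j t) with hf
  have hfm : Measurable f :=
    (hM.measurable_itemSurplus j).ennreal_ofReal.indicator (measurableSet_typeSpace D)
  have hae : ∫⁻ t, ENNReal.ofReal (itemSurplus C M j t) ∂Measure.pi D = ∫⁻ t, f t ∂Measure.pi D := by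
    refine lintegral_congr_ae ?_
    filter_upwards [ae_mem_typeSpace (D := D)] with t ht
    rw [hf, Set.indicator_of_mem ht]
  have hconst : singleProfit (D j) (C.map fun c => c j)
      = ∫⁻ _ : ι → ℝ, singleProfit (D j) (C.map fun c => c j) ∂Measure.pi D := by simp
  rw [hae, hconst]
  refine lintegral_le_of_lmarginal_le {j} hfm measurable_const fun x => ?_
  rw [lmarginal_singleton, lmarginal_singleton]
  simp only [lintegral_const, measure_univ, mul_one]
  by_cases hx : ∀ i, i ≠ j → x i ∈ (D i).support
  · have hmem : ∀ s, Function.update x j s ∈ typeSpace D ↔ s ∈ (D j).support := by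
      intro s
      refine ⟨fun h => by simpa using h j, fun h i => ?_⟩
      rcases eq_or_ne i j with rfl | hi
      · simpa using h
      · rw [Function.update_of_ne hi]
        exact hx i hi
    have hBm : MeasurableSet (D j).support := Measure.isClosed_support.measurableSet
    have e : ∀ s, f (Function.update x j s) = (D j).support.indicator (fun s =>
        ENNReal.ofReal (∫ c, (s - c j) * M.alloc (Function.update x j s) c j ∂C -
          interimUtility C M (Function.update x j s) (Function.update x j s))) s := by
      intro s
      by_cases hs : s ∈ (D j).support
      · rw [Set.indicator_of_mem hs, hf, Set.indicator_of_mem ((hmem s).mpr hs), itemSurplus,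
          Function.update_self]
      · rw [Set.indicator_of_notMem hs, hf, Set.indicator_of_notMem (mt (hmem s).mp hs)]
    simp_rw [e]
    rw [lintegral_indicator hBm]
    refine lintegral_surplus_le (P := C) (μ := D j)
      (ξ := fun s c => M.alloc (Function.update x j s) c j)
      (k := fun c => c j) (U := fun s => interimUtility C M (Function.update x j s)
        (Function.update x j s)) hBm (fun s hs => support_nonneg (hD j) hs)
      (measurable_pi_apply j) (ae_nonneg_apply hC j) ?_ (fun s c => hM.alloc_mem _ c j)
      (fun s hs => hM.ir _ ((hmem s).mpr hs)) fun s hs s' hs' => ?_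
    · exact (hM.measurable_alloc j).comp
        (((measurable_update x).comp measurable_fst).prodMk measurable_snd)
    · rw [← hM.interimUtility_update ((hmem s).mpr hs)]
      exact hM.bic _ ((hmem s').mpr hs') _ ((hmem s).mpr hs)
  · have : ∀ s, f (Function.update x j s) = 0 := by
      intro s
      refine Set.indicator_of_notMem (fun hcon => hx fun i hi => ?_) _
      have := hcon i
      rwa [Function.update_of_ne hi] at this
    simp [this]

/-- The decomposition at one type, with the negative part moved to the right. Summing positive parts
over all `j` removes the need for a measurable choice of the favourite item. -/
theorem lintegral_gain_le [Nonempty ι] (hM : IsBICIR D C M) (hC : ∀ᵐ c ∂C, ∀ j, 0 ≤ c j)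
    {t : ι → ℝ} (ht : t ∈ typeSpace D) :
    ∫⁻ c, ENNReal.ofReal (M.gain t c) ∂C ≤ ∫⁻ c, ENNReal.ofReal (-M.gain t c) ∂C +
      (∑ j, ENNReal.ofReal (itemSurplus C M j t) + ∑ k,
        {t : ι → ℝ | ∃ i, i ≠ k ∧ permitValue C k (t k) ≤ permitValue C i (t i)}.indicator
          (fun t => ENNReal.ofReal (permitValue C k (t k))) t) := by
  classical
  by_cases hneg : ∫⁻ c, ENNReal.ofReal (-M.gain t c) ∂C = ⊤
  · rw [hneg, top_add]
    exact le_top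
  have hcost : ∀ᵐ c ∂C, ∀ j, 0 ≤ c j * M.alloc t c j := by
    filter_upwards [hC] with c hc j using mul_nonneg (hc j) (hM.alloc_mem t c j).1
  have hgm : Measurable (M.gain t) := hM.measurable_gain.comp measurable_prodMk_left
  have hpos : ∫⁻ c, ENNReal.ofReal (M.gain t c) ∂C ≠ ⊤ := by
    refine ((lintegral_mono_ae ?_).trans_lt (hM.integrable_pay t ht).lintegral_lt_top).ne
    filter_upwards [hcost] with c hc
    exact ENNReal.ofReal_le_ofReal (sub_le_self _ (Finset.sum_nonneg fun j _ => hc j))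
  have hg : Integrable (M.gain t) C :=
    integrable_of_lintegral_ofReal hgm.aestronglyMeasurable hpos hneg
  refine (lintegral_ofReal_le_add hg).trans ?_
  gcongr
  -- Integrability of the payment and the gain gives that of the total cost; its terms are almost
  -- surely nonnegative, so each is integrable and the surplus can be split by item.
  have hsum : Integrable (fun c => ∑ j, c j * M.alloc t c j) C := by
    refine ((hM.integrable_pay t ht).sub hg).congr (ae_of_all _ fun c => ?_)
    simp [DirectMechanism.gain]
  have hitem : ∀ j, Integrable (fun c => c j * M.alloc t c j) C := by
    intro j
    refine hsum.mono' ((measurable_pi_apply j).mul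
      (hM.measurable_alloc_right t j)).aestronglyMeasurable ?_
    filter_upwards [hcost] with c hc
    rw [Real.norm_of_nonneg (hc j)]
    exact Finset.single_le_sum (f := fun j => c j * M.alloc t c j) (fun i _ => hc i)
      (Finset.mem_univ j)
  have hsurp : ∀ j, Integrable (fun c => (t j - c j) * M.alloc t c j) C := by
    intro j
    refine (((hM.integrable_alloc t j).const_mul (t j)).sub (hitem j)).congr
      (ae_of_all _ fun c => ?_)
    simp [sub_mul]
  have htot : ∫ c, M.gain t c ∂C
      = ∑ j, ∫ c, (t j - c j) * M.alloc t c j ∂C - interimUtility C M t t := by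
    rw [interimUtility, ← integral_finsetSum _ fun j _ => hsurp j,
      ← integral_sub (integrable_finsetSum _ fun j _ => hsurp j) (hM.integrable_utility ht t)]
    refine integral_congr_ae (ae_of_all _ fun c => ?_)
    simp only [DirectMechanism.gain, sub_mul, Finset.sum_sub_distrib]
    ring
  -- The item of largest permit value absorbs the utility; every other item then lies in its own
  -- overlap event, with `j` as witness.
  obtain ⟨j, -, hj⟩ := Finset.exists_max_image Finset.univ (fun j => permitValue C j (t j))
    Finset.univ_nonempty
  have hle : ∀ i, ∫ c, (t i - c i) * M.alloc t c i ∂C ≤ permitValue C i (t i) := by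
    intro i
    refine integral_mono (hsurp i) (integrable_permit hC i (t i)) fun c => ?_
    have h1 := hM.alloc_mem t c i
    have h2 : t i - c i ≤ max (t i - c i) 0 := le_max_left _ _
    have h3 : 0 ≤ max (t i - c i) 0 := le_max_right _ _
    simp only
    nlinarith [mul_le_mul_of_nonneg_right h2 h1.1, h1.2]
  have hbound : ∫ c, M.gain t c ∂C
      ≤ itemSurplus C M j t + ∑ i ∈ Finset.univ.erase j, permitValue C i (t i) := by
    rw [htot, itemSurplus, ← Finset.add_sum_erase _ _ (Finset.mem_univ j)]
    have := Finset.sum_le_sum fun i (_ : i ∈ Finset.univ.erase j) => hle i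
    linarith
  refine (ENNReal.ofReal_le_ofReal hbound).trans (ENNReal.ofReal_add_le.trans ?_)
  gcongr
  · exact Finset.single_le_sum (f := fun j => ENNReal.ofReal (itemSurplus C M j t))
      (fun i _ => zero_le) (Finset.mem_univ j)
  · rw [ENNReal.ofReal_sum_of_nonneg fun i _ => permitValue_nonneg i (t i)]
    refine le_trans (Finset.sum_le_sum fun i hi => ?_)
      (Finset.sum_le_sum_of_subset (Finset.erase_subset j Finset.univ))
    rw [Set.indicator_of_mem]
    exact ⟨j, (Finset.ne_of_mem_erase hi).symm, hj i (Finset.mem_univ i)⟩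

theorem profit_le [Nonempty ι] (hM : IsBICIR D C M) (hD : ∀ j, ∀ᵐ x ∂(D j), 0 ≤ x)
    (hC : ∀ᵐ c ∂C, ∀ j, 0 ≤ c j) :
    profit D C M ≤ ((∑ j, singleProfit (D j) (C.map fun c => c j) + ∑ k, overlap D C k : ℝ≥0∞) :
      EReal) := by
  have hg := hM.measurable_gain
  have hg' : Measurable fun z : (ι → ℝ) × (ι → ℝ) => -M.gain z.1 z.2 := hg.neg
  have hset : ∀ k, MeasurableSet
      {t : ι → ℝ | ∃ i, i ≠ k ∧ permitValue C k (t k) ≤ permitValue C i (t i)} := by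
    intro k
    have hm : ∀ i, Measurable fun t : ι → ℝ => permitValue C i (t i) := fun i =>
      (permitValue_monotone hC i).measurable.comp (measurable_pi_apply i)
    have : {t : ι → ℝ | ∃ i, i ≠ k ∧ permitValue C k (t k) ≤ permitValue C i (t i)}
        = ⋃ i, ⋃ (_ : i ≠ k), {t | permitValue C k (t k) ≤ permitValue C i (t i)} := by
      ext t
      simp
    rw [this]
    exact MeasurableSet.iUnion fun i => MeasurableSet.iUnion fun _ =>
      measurableSet_le (hm k) (hm i)
  have hpm : ∀ k, Measurable fun t : ι → ℝ => ENNReal.ofReal (permitValue C k (t k)) := fun k =>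
    ((permitValue_monotone hC k).measurable.comp (measurable_pi_apply k)).ennreal_ofReal
  have key : ∫⁻ z, ENNReal.ofReal (M.gain z.1 z.2) ∂(Measure.pi D).prod C
      ≤ (∑ j, singleProfit (D j) (C.map fun c => c j) + ∑ k, overlap D C k) +
        ∫⁻ z, ENNReal.ofReal (-M.gain z.1 z.2) ∂(Measure.pi D).prod C := by
    rw [lintegral_prod _ hg.ennreal_ofReal.aemeasurable,
      lintegral_prod _ hg'.ennreal_ofReal.aemeasurable]
    refine (lintegral_mono_ae ((ae_mem_typeSpace (D := D)).mono fun t ht =>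
      hM.lintegral_gain_le hC ht)).trans ?_
    rw [lintegral_add_left hg'.ennreal_ofReal.lintegral_prod_right', add_comm]
    gcongr
    rw [lintegral_add_left (Finset.measurable_sum _ fun j _ =>
        (hM.measurable_itemSurplus j).ennreal_ofReal),
      lintegral_finsetSum _ fun j _ => (hM.measurable_itemSurplus j).ennreal_ofReal,
      lintegral_finsetSum _ fun k _ => (hpm k).indicator (hset k)]
    gcongr with j _ k _
    · exact hM.lintegral_itemSurplus_le hD hC j
    · rw [lintegral_indicator (hset k), overlap]
  rw [profit, extExpectation]
  refine EReal.sub_le_of_le_add ?_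
  exact_mod_cast key

end IsBICIR

theorem optProfit_le [Nonempty ι] (hD : ∀ j, ∀ᵐ x ∂(D j), 0 ≤ x) (hC : ∀ᵐ c ∂C, ∀ j, 0 ≤ c j) :
    optProfit D C ≤ ((∑ j, singleProfit (D j) (C.map fun c => c j) + ∑ k, overlap D C k : ℝ≥0∞) :
      EReal) :=
  iSup₂_le fun _ hM => hM.profit_le hD hC

end Mechanism

end

section


/-! ### Measurable choice of posted prices -/

/-- Lowering a price slightly cannot reduce the sale probability and changes the margin
continuously, so a countable dense set of prices suffices. -/
theorem postedProfit_le_iSup_denseSeq (μ : Measure ℝ) [IsFiniteMeasure μ] (c : ℝ) :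
    postedProfit μ c ≤ ⨆ i : ℕ, ENNReal.ofReal (TopologicalSpace.denseSeq ℝ i - c) *
      μ (Set.Ici (TopologicalSpace.denseSeq ℝ i)) := by
  refine iSup_le fun p => ?_
  by_contra! hlt
  set S := ⨆ i : ℕ, ENNReal.ofReal (TopologicalSpace.denseSeq ℝ i - c) *
      μ (Set.Ici (TopologicalSpace.denseSeq ℝ i)) with hS
  have hlim : Tendsto (fun p' : ℝ => ENNReal.ofReal (p' - c) * μ (Set.Ici p)) (𝓝 p)
      (𝓝 (ENNReal.ofReal (p - c) * μ (Set.Ici p))) := by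
    refine ENNReal.Tendsto.mul_const ?_ (Or.inr (measure_ne_top _ _))
    exact ENNReal.tendsto_ofReal (tendsto_id.sub_const c)
  obtain ⟨l, hl, hsub⟩ := exists_Ioc_subset_of_mem_nhds (hlim.eventually_const_lt hlt)
    ⟨p - 1, by linarith⟩
  obtain ⟨i, hi⟩ := (TopologicalSpace.denseRange_denseSeq ℝ).exists_mem_open isOpen_Ioo
    (Set.nonempty_Ioo.mpr hl)
  have h1 : S < ENNReal.ofReal (TopologicalSpace.denseSeq ℝ i - c) * μ (Set.Ici p) :=
    hsub ⟨hi.1, hi.2.le⟩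
  have h2 : ENNReal.ofReal (TopologicalSpace.denseSeq ℝ i - c) * μ (Set.Ici p) ≤ S := by
    refine le_trans ?_ (le_iSup (fun i : ℕ => ENNReal.ofReal (TopologicalSpace.denseSeq ℝ i - c) *
      μ (Set.Ici (TopologicalSpace.denseSeq ℝ i))) i)
    gcongr
    exact hi.2.le
  exact absurd h1 (not_lt.mpr h2)

theorem measurable_measure_Ici (μ : Measure ℝ) : Measurable fun p : ℝ => μ (Set.Ici p) :=
  Antitone.measurable fun _ _ h => measure_mono (Set.Ici_subset_Ici.mpr h)

/-- A running maximum over finitely many candidates, started from the price `c` itself. It earns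
zero, so no price below cost is ever selected. -/
theorem exists_measurable_price (μ : Measure ℝ) (q : ℕ → ℝ) (N : ℕ) :
    ∃ f : ℝ → ℝ, Measurable f ∧ (∀ c, c ≤ f c) ∧ ∀ c, ∀ i < N,
      ENNReal.ofReal (q i - c) * μ (Set.Ici (q i))
        ≤ ENNReal.ofReal (f c - c) * μ (Set.Ici (f c)) := by
  induction N with
  | zero => exact ⟨id, measurable_id, fun _ => le_rfl, fun _ _ h => absurd h (Nat.not_lt_zero _)⟩
  | succ N ih =>
    obtain ⟨f, hfm, hfc, hf⟩ := ih
    have hset : MeasurableSet {c | ENNReal.ofReal (f c - c) * μ (Set.Ici (f c))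
        < ENNReal.ofReal (q N - c) * μ (Set.Ici (q N))} := by
      refine measurableSet_lt ?_ ?_
      · exact (hfm.sub measurable_id).ennreal_ofReal.mul ((measurable_measure_Ici μ).comp hfm)
      · exact (measurable_const.sub measurable_id).ennreal_ofReal.mul measurable_const
    classical
    refine ⟨fun c => if ENNReal.ofReal (f c - c) * μ (Set.Ici (f c))
        < ENNReal.ofReal (q N - c) * μ (Set.Ici (q N)) then q N else f c,
      Measurable.ite hset measurable_const hfm, fun c => ?_, fun c i hi => ?_⟩
    · simp only
      split_ifs with h
      · by_contra hlt
        rw [ENNReal.ofReal_of_nonpos (by linarith [not_le.mp hlt] : q N - c ≤ 0), zero_mul] at h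
        exact not_lt_zero h
      · exact hfc c
    · simp only
      rcases Nat.lt_succ_iff_lt_or_eq.mp hi with hi | rfl
      · split_ifs with h
        · exact (hf c i hi).trans h.le
        · exact hf c i hi
      · split_ifs with h
        · exact le_rfl
        · exact not_lt.mp h

variable {ι : Type*} [Fintype ι] {D : ι → Measure ℝ} {C : Measure (ι → ℝ)}
  [∀ j, IsProbabilityMeasure (D j)] [IsProbabilityMeasure C]

/-- Prices are optimized over the first `N` candidates, and `N → ∞` by monotone convergence. The
bound `R` is left free because it is later taken to be either IP or OPT. -/
theorem sum_singleProfit_le {R : ℝ≥0∞}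
    (h : ∀ p : (ι → ℝ) → ι → ℝ, Measurable p → (∀ c j, c j ≤ p c j) →
      ∑ j, ∫⁻ c, ENNReal.ofReal (p c j - c j) * D j (Set.Ici (p c j)) ∂C ≤ R) :
    ∑ j, singleProfit (D j) (C.map fun c => c j) ≤ R := by
  set q : ℕ → ℝ := TopologicalSpace.denseSeq ℝ with hq
  set G : ι → ℕ → ℝ → ℝ≥0∞ := fun j N c =>
    ⨆ i : ℕ, ⨆ (_ : i < N), ENNReal.ofReal (q i - c) * D j (Set.Ici (q i)) with hG
  have hGm : ∀ j N, Measurable (G j N) := fun j N =>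
    Measurable.iSup fun i => Measurable.iSup fun _ =>
      (measurable_const.sub measurable_id).ennreal_ofReal.mul measurable_const
  have hGmono : ∀ j, Monotone (G j) := fun j N N' hN c =>
    iSup_mono fun i => iSup_le fun hi => le_iSup_of_le (hi.trans_le hN) le_rfl
  have hpost : ∀ j c, postedProfit (D j) c ≤ ⨆ N, G j N c := fun j c =>
    (postedProfit_le_iSup_denseSeq (D j) c).trans <| iSup_le fun i =>
      le_iSup_of_le (i + 1) (le_iSup₂_of_le i (Nat.lt_succ_self i) le_rfl)
  have hsingle : ∀ j, singleProfit (D j) (C.map fun c => c j)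
      ≤ ⨆ N, ∫⁻ c, G j N (c j) ∂C := by
    intro j
    have e := lintegral_iSup (μ := C) (f := fun N (c : ι → ℝ) => G j N (c j))
      (fun N => (hGm j N).comp (measurable_pi_apply j)) fun N N' hN c => hGmono j hN (c j)
    rw [singleProfit, lintegral_map (measurable_postedProfit _) (measurable_pi_apply j), ← e]
    exact lintegral_mono fun c => hpost j (c j)
  refine (Finset.sum_le_sum fun j _ => hsingle j).trans ?_
  rw [ENNReal.finsetSum_iSup_of_monotone fun j N N' hN => lintegral_mono fun c => hGmono j hN (c j)]
  refine iSup_le fun N => ?_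
  choose f hfm hfc hf using fun j => exists_measurable_price (D j) q N
  refine le_trans (Finset.sum_le_sum fun j _ => lintegral_mono fun c => ?_)
    (h (fun c j => f j (c j))
      (measurable_pi_iff.mpr fun j => (hfm j).comp (measurable_pi_apply j))
      fun c j => hfc j (c j))
  exact iSup₂_le fun i hi => hf j (c j) i hi

/-! ### Item posted pricing -/

section ItemPricing

variable {p : (ι → ℝ) → ι → ℝ}

theorem measurableSet_sale (hp : Measurable p) (j : ι) :
    MeasurableSet {z : (ι → ℝ) × (ι → ℝ) | p z.2 j ≤ z.1 j} :=
  measurableSet_le (((measurable_pi_apply j).comp hp).comp measurable_snd)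
    ((measurable_pi_apply j).comp measurable_fst)

theorem measurable_sale (hp : Measurable p) (j : ι) {f : (ι → ℝ) × (ι → ℝ) → ℝ}
    (hf : Measurable f) :
    Measurable fun z : (ι → ℝ) × (ι → ℝ) => if p z.2 j ≤ z.1 j then f z else 0 :=
  Measurable.ite (measurableSet_sale hp j) hf measurable_const

/-- Prices at or above cost make the gain nonnegative pointwise, so the negative part in
`extExpectation` is zero and Tonelli gives the formula. -/
theorem profit_itemPricing (hp : Measurable p) (hcp : ∀ c j, c j ≤ p c j) :
    profit D C (itemPricing p) =
      ((∑ j, ∫⁻ c, ENNReal.ofReal (p c j - c j) * D j (Set.Ici (p c j)) ∂C : ℝ≥0∞) : EReal) := by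
  have hgain : ∀ z : (ι → ℝ) × (ι → ℝ), (itemPricing p).pay z.1 z.2
      - ∑ j, z.2 j * (itemPricing p).alloc z.1 z.2 j
        = ∑ j, if p z.2 j ≤ z.1 j then p z.2 j - z.2 j else 0 := by
    intro z
    simp only [itemPricing]
    rw [← Finset.sum_sub_distrib]
    refine Finset.sum_congr rfl fun j _ => ?_
    split_ifs <;> simp
  have hnn : ∀ (z : (ι → ℝ) × (ι → ℝ)) j, 0 ≤ if p z.2 j ≤ z.1 j then p z.2 j - z.2 j else 0 := by
    intro z j
    split_ifs
    · linarith [hcp z.2 j]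
    · exact le_rfl
  have hm : ∀ j, Measurable fun z : (ι → ℝ) × (ι → ℝ) =>
      if p z.2 j ≤ z.1 j then p z.2 j - z.2 j else 0 := fun j =>
    measurable_sale hp j ((((measurable_pi_apply j).comp hp).comp measurable_snd).sub
      ((measurable_pi_apply j).comp measurable_snd))
  rw [profit, extExpectation]
  simp_rw [hgain]
  have hneg : ∫⁻ z : (ι → ℝ) × (ι → ℝ), ENNReal.ofReal
      (-∑ j, if p z.2 j ≤ z.1 j then p z.2 j - z.2 j else 0) ∂(Measure.pi D).prod C = 0 := by
    rw [← lintegral_zero (μ := (Measure.pi D).prod C)]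
    refine lintegral_congr fun z => ENNReal.ofReal_of_nonpos ?_
    linarith [Finset.sum_nonneg fun j (_ : j ∈ Finset.univ) => hnn z j]
  rw [hneg, EReal.coe_ennreal_zero, sub_zero]
  congr 1
  simp_rw [ENNReal.ofReal_sum_of_nonneg fun j _ => hnn _ j]
  rw [lintegral_finsetSum _ fun j _ => (hm j).ennreal_ofReal]
  refine Finset.sum_congr rfl fun j _ => ?_
  rw [lintegral_prod_symm _ (hm j).ennreal_ofReal.aemeasurable]
  refine lintegral_congr fun c => ?_
  have hset : MeasurableSet {t : ι → ℝ | p c j ≤ t j} :=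
    measurableSet_le measurable_const (measurable_pi_apply j)
  have : ∀ t : ι → ℝ, ENNReal.ofReal (if p c j ≤ t j then p c j - c j else 0)
      = {t : ι → ℝ | p c j ≤ t j}.indicator (fun _ => ENNReal.ofReal (p c j - c j)) t := by
    intro t
    by_cases h : p c j ≤ t j
    · rw [if_pos h, Set.indicator_of_mem (by exact h)]
    · rw [if_neg h, Set.indicator_of_notMem (by exact h), ENNReal.ofReal_zero]
  simp_rw [this]
  rw [lintegral_indicator hset, setLIntegral_const]
  congr 1
  exact (measurePreserving_eval D j).measure_preimage measurableSet_Ici.nullMeasurableSet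

theorem isBICIR_itemPricing (hC : ∀ᵐ c ∂C, ∀ j, 0 ≤ c j) (hp : Measurable p)
    (hcp : ∀ c j, c j ≤ p c j) : IsBICIR D C (itemPricing p) := by
  have hpay : ∀ t, Integrable ((itemPricing p).pay t) C := by
    intro t
    refine integrable_finsetSum _ fun j _ => ?_
    have hm : Measurable fun c => if p c j ≤ t j then p c j else 0 :=
      (measurable_sale hp j (((measurable_pi_apply j).comp hp).comp measurable_snd)).comp
        (measurable_prodMk_left (x := t))
    refine Integrable.of_bound hm.aestronglyMeasurable |t j| ?_
    filter_upwards [hC] with c hc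
    split_ifs with h
    · rw [Real.norm_of_nonneg ((hc j).trans (hcp c j))]
      exact h.trans (le_abs_self _)
    · simp
  have hutil : ∀ t t' : ι → ℝ, Integrable
      (fun c => (∑ j, t j * (itemPricing p).alloc t' c j) - (itemPricing p).pay t' c) C := by
    intro t t'
    refine (integrable_finsetSum _ fun j _ => Integrable.const_mul ?_ _).sub (hpay t')
    refine Integrable.of_bound (((measurable_sale hp j measurable_const).comp
      (measurable_prodMk_left (x := t'))).aestronglyMeasurable) 1 (ae_of_all _ fun c => ?_)
    simp only [itemPricing]
    split_ifs <;> simp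
  have heq : ∀ t t' c : ι → ℝ, (∑ j, t j * (itemPricing p).alloc t' c j) - (itemPricing p).pay t' c
      = ∑ j, if p c j ≤ t' j then t j - p c j else 0 := by
    intro t t' c
    simp only [itemPricing]
    rw [← Finset.sum_sub_distrib]
    refine Finset.sum_congr rfl fun j _ => ?_
    split_ifs <;> simp
  refine ⟨fun j => measurable_sale hp j measurable_const, ?_, fun t c j => ?_, fun t _ => hpay t,
    fun t _ t' _ => ?_, fun t _ => ?_⟩
  · exact Finset.measurable_sum _ fun j _ =>
      measurable_sale hp j (((measurable_pi_apply j).comp hp).comp measurable_snd)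
  · simp only [itemPricing]
    split_ifs <;> simp
  · refine integral_mono (hutil t t') (hutil t t) fun c => ?_
    simp only [heq]
    refine Finset.sum_le_sum fun j _ => ?_
    split_ifs <;> linarith
  · refine integral_nonneg fun c => ?_
    simp only [heq]
    refine Finset.sum_nonneg fun j _ => ?_
    split_ifs <;> simp_all

end ItemPricing

/-! ### Permit posted pricing -/

/-- The optimal revenue from selling the permit for item `j` at a posted price. -/
def permitRevenue (μ : Measure ℝ) (C : Measure (ι → ℝ)) (j : ι) : ℝ≥0∞ :=
  ⨆ l : ℝ, ENNReal.ofReal l * μ {x | l ≤ permitValue C j x}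

theorem sum_permitRevenue_le {R : ℝ≥0∞}
    (h : ∀ l : ι → ℝ, (∀ j, 0 ≤ l j) →
      ∑ j, ENNReal.ofReal (l j) * D j {x | l j ≤ permitValue C j x} ≤ R) :
    ∑ j, permitRevenue (D j) C j ≤ R := by
  classical
  have h1 : ∀ j, permitRevenue (D j) C j
      ≤ ⨆ l : ι → ℝ, ENNReal.ofReal (l j) * D j {x | l j ≤ permitValue C j x} := fun j =>
    iSup_le fun x => le_iSup_of_le (fun _ => x) le_rfl
  refine (Finset.sum_le_sum fun j _ => h1 j).trans ?_
  rw [ENNReal.finsetSum_iSup]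
  · refine iSup_le fun l => le_trans (Finset.sum_le_sum fun j _ => ?_)
      (h (fun j => max (l j) 0) fun j => le_max_right _ _)
    rcases le_total (l j) 0 with hl | hl
    · rw [ENNReal.ofReal_of_nonpos hl, zero_mul]
      exact zero_le
    · rw [max_eq_left hl]
  -- Permit prices are chosen item by item, so two price vectors have a common improvement: the
  -- better entry for each item.
  · intro l l'
    refine ⟨fun j => if ENNReal.ofReal (l j) * D j {x | l j ≤ permitValue C j x}
      ≤ ENNReal.ofReal (l' j) * D j {x | l' j ≤ permitValue C j x} then l' j else l j, fun j => ?_⟩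
    simp only
    split_ifs with hle
    · exact ⟨hle, le_rfl⟩
    · exact ⟨le_rfl, (not_le.mp hle).le⟩

section PermitPricing

variable {l : ι → ℝ}

theorem measurableSet_permit (hC : ∀ᵐ c ∂C, ∀ j, 0 ≤ c j) (l : ι → ℝ) (j : ι) :
    MeasurableSet {x | l j ≤ permitValue C j x} :=
  measurableSet_le measurable_const (permitValue_monotone hC j).measurable

theorem profit_permitPricing (hC : ∀ᵐ c ∂C, ∀ j, 0 ≤ c j) (hl : ∀ j, 0 ≤ l j) :
    profit D C (permitPricing C l) =
      ((∑ j, ENNReal.ofReal (l j) * D j {x | l j ≤ permitValue C j x} : ℝ≥0∞) : EReal) := by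
  have hgain : ∀ z : (ι → ℝ) × (ι → ℝ), (permitPricing C l).pay z.1 z.2
      - ∑ j, z.2 j * (permitPricing C l).alloc z.1 z.2 j
        = ∑ j, if l j ≤ permitValue C j (z.1 j) then l j else 0 := by
    intro z
    simp only [permitPricing]
    rw [← Finset.sum_sub_distrib]
    refine Finset.sum_congr rfl fun j _ => ?_
    split_ifs <;> simp
  have hnn : ∀ (z : (ι → ℝ) × (ι → ℝ)) j,
      0 ≤ if l j ≤ permitValue C j (z.1 j) then l j else 0 := by
    intro z j
    split_ifs
    · exact hl j
    · exact le_rfl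
  have hset : ∀ j, MeasurableSet {t : ι → ℝ | l j ≤ permitValue C j (t j)} := fun j =>
    (measurableSet_permit hC l j).preimage (measurable_pi_apply j)
  have hm : ∀ j, Measurable fun t : ι → ℝ =>
      if l j ≤ permitValue C j (t j) then l j else 0 := fun j =>
    Measurable.ite (hset j) measurable_const measurable_const
  rw [profit, extExpectation]
  simp_rw [hgain]
  have hneg : ∫⁻ z : (ι → ℝ) × (ι → ℝ), ENNReal.ofReal
      (-∑ j, if l j ≤ permitValue C j (z.1 j) then l j else 0) ∂(Measure.pi D).prod C = 0 := by
    rw [← lintegral_zero (μ := (Measure.pi D).prod C)]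
    refine lintegral_congr fun z => ENNReal.ofReal_of_nonpos ?_
    linarith [Finset.sum_nonneg fun j (_ : j ∈ Finset.univ) => hnn z j]
  rw [hneg, EReal.coe_ennreal_zero, sub_zero]
  congr 1
  simp_rw [ENNReal.ofReal_sum_of_nonneg fun j _ => hnn _ j]
  have hm' : ∀ j, Measurable fun z : (ι → ℝ) × (ι → ℝ) =>
      if l j ≤ permitValue C j (z.1 j) then l j else 0 := fun j => (hm j).comp measurable_fst
  rw [lintegral_finsetSum _ fun j _ => (hm' j).ennreal_ofReal]
  refine Finset.sum_congr rfl fun j _ => ?_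
  rw [lintegral_prod _ (hm' j).ennreal_ofReal.aemeasurable]
  have : ∀ t : ι → ℝ, ENNReal.ofReal (if l j ≤ permitValue C j (t j) then l j else 0)
      = {t : ι → ℝ | l j ≤ permitValue C j (t j)}.indicator (fun _ => ENNReal.ofReal (l j)) t := by
    intro t
    by_cases h : l j ≤ permitValue C j (t j)
    · rw [if_pos h, Set.indicator_of_mem (by exact h)]
    · rw [if_neg h, Set.indicator_of_notMem (by exact h), ENNReal.ofReal_zero]
  simp_rw [this, lintegral_const, measure_univ, mul_one]
  rw [lintegral_indicator (hset j), setLIntegral_const]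
  congr 1
  exact (measurePreserving_eval D j).measure_preimage
    (measurableSet_permit hC l j).nullMeasurableSet

theorem isBICIR_permitPricing (hC : ∀ᵐ c ∂C, ∀ j, 0 ≤ c j) (l : ι → ℝ) :
    IsBICIR D C (permitPricing C l) := by
  have hset : ∀ j, MeasurableSet {z : (ι → ℝ) × (ι → ℝ) | l j ≤ permitValue C j (z.1 j)} :=
    fun j => (measurableSet_permit hC l j).preimage ((measurable_pi_apply j).comp measurable_fst)
  have hsale : ∀ j, MeasurableSet
      {z : (ι → ℝ) × (ι → ℝ) | l j ≤ permitValue C j (z.1 j) ∧ z.2 j ≤ z.1 j} := fun j =>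
    (hset j).inter (measurableSet_le ((measurable_pi_apply j).comp measurable_snd)
      ((measurable_pi_apply j).comp measurable_fst))
  have hma : ∀ j, Measurable fun z : (ι → ℝ) × (ι → ℝ) =>
      (if l j ≤ permitValue C j (z.1 j) ∧ z.2 j ≤ z.1 j then 1 else 0 : ℝ) := fun j =>
    Measurable.ite (hsale j) measurable_const measurable_const
  have hmc : ∀ j, Measurable fun z : (ι → ℝ) × (ι → ℝ) =>
      if l j ≤ permitValue C j (z.1 j) ∧ z.2 j ≤ z.1 j then z.2 j else 0 := fun j =>
    Measurable.ite (hsale j) ((measurable_pi_apply j).comp measurable_snd) measurable_const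
  have hci : ∀ (t : ι → ℝ) j, Integrable (fun c : ι → ℝ =>
      if l j ≤ permitValue C j (t j) ∧ c j ≤ t j then c j else 0) C := by
    intro t j
    refine Integrable.of_bound ((hmc j).comp (measurable_prodMk_left (x := t))).aestronglyMeasurable
      |t j| ?_
    filter_upwards [hC] with c hc
    split_ifs with h
    · rw [Real.norm_of_nonneg (hc j)]
      exact h.2.trans (le_abs_self _)
    · simp
  have hai : ∀ t j, Integrable (fun c : ι → ℝ => (permitPricing C l).alloc t c j) C := by
    intro t j
    refine Integrable.of_bound ((hma j).comp (measurable_prodMk_left (x := t))).aestronglyMeasurable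
      1 (ae_of_all _ fun c => ?_)
    simp only [permitPricing]
    split_ifs <;> simp
  have hpay : ∀ t, Integrable ((permitPricing C l).pay t) C := fun t =>
    integrable_finsetSum _ fun j _ => (integrable_const _).add (hci t j)
  have hint : ∀ (t t' : ι → ℝ) j, Integrable (fun c : ι → ℝ =>
      t j * (permitPricing C l).alloc t' c j -
        ((if l j ≤ permitValue C j (t' j) then l j else 0) +
          if l j ≤ permitValue C j (t' j) ∧ c j ≤ t' j then c j else 0)) C := fun t t' j =>
    ((hai t' j).const_mul _).sub ((integrable_const _).add (hci t' j))
  have hutil : ∀ t t' : ι → ℝ, interimUtility C (permitPricing C l) t t' = ∑ j, ∫ c : ι → ℝ,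
      (t j * (permitPricing C l).alloc t' c j -
        ((if l j ≤ permitValue C j (t' j) then l j else 0) +
          if l j ≤ permitValue C j (t' j) ∧ c j ≤ t' j then c j else 0)) ∂C := by
    intro t t'
    rw [interimUtility, ← integral_finsetSum _ fun j _ => hint t t' j]
    refine integral_congr_ae (ae_of_all _ fun c => ?_)
    simp only [permitPricing, Finset.sum_sub_distrib]
  -- Whatever the report, item `j` yields at most `max (permitValue - l j) 0`; `htruth` shows that
  -- truth-telling attains it. BIC and IR follow item by item.
  have hbound : ∀ (t t' : ι → ℝ) j, ∫ c : ι → ℝ, (t j * (permitPricing C l).alloc t' c j -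
        ((if l j ≤ permitValue C j (t' j) then l j else 0) +
          if l j ≤ permitValue C j (t' j) ∧ c j ≤ t' j then c j else 0)) ∂C
        ≤ max (permitValue C j (t j) - l j) 0 := by
    intro t t' j
    by_cases h : l j ≤ permitValue C j (t' j)
    · refine le_trans ?_ (le_max_left _ _)
      have e : permitValue C j (t j) - l j = ∫ c : ι → ℝ, (max (t j - c j) 0 - l j) ∂C := by
        rw [integral_sub (integrable_permit hC j (t j)) (integrable_const _), permitValue]
        simp
      rw [e]
      refine integral_mono (hint t t' j) ((integrable_permit hC j _).sub (integrable_const _))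
        fun c => ?_
      simp only [permitPricing, h, true_and, if_true]
      have := le_max_left (t j - c j) 0
      have := le_max_right (t j - c j) 0
      split_ifs <;> linarith
    · simp [permitPricing, h]
  have htruth : ∀ (t : ι → ℝ) j, ∫ c : ι → ℝ, (t j * (permitPricing C l).alloc t c j -
        ((if l j ≤ permitValue C j (t j) then l j else 0) +
          if l j ≤ permitValue C j (t j) ∧ c j ≤ t j then c j else 0)) ∂C
        = max (permitValue C j (t j) - l j) 0 := by
    intro t j
    by_cases h : l j ≤ permitValue C j (t j)
    · rw [max_eq_left (sub_nonneg.mpr h)]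
      have e : permitValue C j (t j) - l j = ∫ c : ι → ℝ, (max (t j - c j) 0 - l j) ∂C := by
        rw [integral_sub (integrable_permit hC j (t j)) (integrable_const _), permitValue]
        simp
      rw [e]
      refine integral_congr_ae (ae_of_all _ fun c => ?_)
      simp only [permitPricing, h, true_and, if_true]
      by_cases hc : c j ≤ t j
      · rw [if_pos hc, if_pos hc, max_eq_left (sub_nonneg.mpr hc)]
        ring
      · rw [if_neg hc, if_neg hc, max_eq_right (by linarith [not_le.mp hc])]
        ring
    · rw [max_eq_right (by linarith [not_le.mp h])]
      simp [permitPricing, h]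
  refine ⟨hma, ?_, fun t c j => ?_, fun t _ => hpay t, fun t _ t' _ => ?_, fun t _ => ?_⟩
  · exact Finset.measurable_sum _ fun j _ =>
      (Measurable.ite (hset j) measurable_const measurable_const).add (hmc j)
  · simp only [permitPricing]
    split_ifs <;> simp
  · rw [hutil, hutil]
    refine Finset.sum_le_sum fun j _ => ?_
    rw [htruth]
    exact hbound t t' j
  · rw [hutil]
    refine Finset.sum_nonneg fun j _ => ?_
    rw [htruth]
    exact le_max_right _ _

end PermitPricing

end

section


/-! ### Bounding the overlap by permit revenues -/

/-- Layer-cake formula: tail probabilities are at most `1` up to level `b / m`, at most `r / l` from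
there to `b`, and zero above. The middle range contributes `r ∫ dl / l = r log m`. -/
theorem lintegral_min_le {α : Type*} [MeasurableSpace α] {μ : Measure α} [IsProbabilityMeasure μ]
    {u : α → ℝ} (hu : Measurable u) (hu0 : ∀ x, 0 ≤ u x) {r : ℝ≥0∞}
    (hr : ∀ l : ℝ, ENNReal.ofReal l * μ {x | l ≤ u x} ≤ r) {b : ℝ} (hb : 0 < b) {m : ℝ}
    (hm : 1 ≤ m) :
    ∫⁻ x, min (ENNReal.ofReal (u x)) (ENNReal.ofReal b) ∂μ
      ≤ ENNReal.ofReal (b / m) + ENNReal.ofReal (Real.log m) * r := by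
  have hm0 : 0 < m := by linarith
  have hbm : 0 < b / m := div_pos hb hm0
  have hbm' : b / m ≤ b := div_le_self hb.le hm
  simp_rw [← ENNReal.ofReal_min]
  rw [lintegral_eq_lintegral_meas_le μ (ae_of_all _ fun x => le_min (hu0 x) hb.le)
    (hu.min measurable_const).aemeasurable]
  have hsub : Set.Ioi (0 : ℝ) ⊆ (Set.Ioc 0 (b / m) ∪ Set.Ioc (b / m) b) ∪ Set.Ioi b := by
    intro x hx
    rcases le_or_gt x (b / m) with h | h
    · exact Or.inl (Or.inl ⟨hx, h⟩)
    rcases le_or_gt x b with h' | h'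
    · exact Or.inl (Or.inr ⟨h, h'⟩)
    · exact Or.inr h'
  have h3 : ∫⁻ l in Set.Ioi b, μ {x | l ≤ min (u x) b} = 0 := by
    rw [setLIntegral_congr_fun (g := fun _ => 0) measurableSet_Ioi, lintegral_zero]
    intro l hl
    have : {x | l ≤ min (u x) b} = ∅ := by
      ext x
      simp only [Set.mem_ofPred_eq, Set.mem_empty_iff_false, iff_false, not_le]
      exact (min_le_right _ _).trans_lt hl
    simp only [this, measure_empty]
  have h1 : ∫⁻ l in Set.Ioc 0 (b / m), μ {x | l ≤ min (u x) b} ≤ ENNReal.ofReal (b / m) := by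
    calc _ ≤ ∫⁻ _ in Set.Ioc 0 (b / m), 1 := lintegral_mono fun l => prob_le_one
      _ = ENNReal.ofReal (b / m) := by simp
  have h2 : ∫⁻ l in Set.Ioc (b / m) b, μ {x | l ≤ min (u x) b}
      ≤ ENNReal.ofReal (Real.log m) * r := by
    have hle : ∀ l ∈ Set.Ioc (b / m) b, μ {x | l ≤ min (u x) b} ≤ ENNReal.ofReal l⁻¹ * r := by
      intro l hl
      have hl0 : 0 < l := hbm.trans hl.1
      have h4 : μ {x | l ≤ min (u x) b} ≤ μ {x | l ≤ u x} :=
        measure_mono fun x (hx : l ≤ min (u x) b) => (le_min_iff.mp hx).1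
      refine h4.trans ?_
      calc μ {x | l ≤ u x}
          = ENNReal.ofReal l⁻¹ * (ENNReal.ofReal l * μ {x | l ≤ u x}) := by
            rw [← mul_assoc, ← ENNReal.ofReal_mul (inv_nonneg.mpr hl0.le),
              inv_mul_cancel₀ hl0.ne', ENNReal.ofReal_one, one_mul]
        _ ≤ ENNReal.ofReal l⁻¹ * r := by gcongr; exact hr l
    refine (setLIntegral_mono' measurableSet_Ioc hle).trans ?_
    rw [lintegral_mul_const _ (by fun_prop)]
    gcongr
    have hint : IntegrableOn (fun l : ℝ => l⁻¹) (Set.Ioc (b / m) b) := by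
      rw [← intervalIntegrable_iff_integrableOn_Ioc_of_le hbm']
      refine intervalIntegral.intervalIntegrable_inv (fun x hx => ?_) continuousOn_id
      rw [Set.uIcc_of_le hbm'] at hx
      exact (hbm.trans_le hx.1).ne'
    rw [← ofReal_integral_eq_lintegral_ofReal hint]
    · rw [← intervalIntegral.integral_of_le hbm', integral_inv_of_pos hbm hb]
      refine le_of_eq ?_
      congr 2
      field_simp
    · filter_upwards [ae_restrict_mem measurableSet_Ioc] with l hl
      exact inv_nonneg.mpr (hbm.trans hl.1).le
  calc _ ≤ ∫⁻ l in (Set.Ioc 0 (b / m) ∪ Set.Ioc (b / m) b) ∪ Set.Ioi b, μ {x | l ≤ min (u x) b} :=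
        lintegral_mono_set hsub
    _ ≤ ((∫⁻ l in Set.Ioc 0 (b / m), μ {x | l ≤ min (u x) b})
          + (∫⁻ l in Set.Ioc (b / m) b, μ {x | l ≤ min (u x) b}))
          + ∫⁻ l in Set.Ioi b, μ {x | l ≤ min (u x) b} := by
        exact (lintegral_union_le _ _ _).trans (add_le_add_left (lintegral_union_le _ _ _) _)
    _ ≤ _ := by
        rw [h3, add_zero]
        exact add_le_add h1 h2

variable {ι : Type*} [Fintype ι] {D : ι → Measure ℝ} {C : Measure (ι → ℝ)}
  [∀ j, IsProbabilityMeasure (D j)] [IsProbabilityMeasure C]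

theorem ofReal_mul_measure_permit_le (μ : Measure ℝ) (j : ι) (l : ℝ) :
    ENNReal.ofReal l * μ {x | l ≤ permitValue C j x} ≤ permitRevenue μ C j :=
  le_iSup (fun l : ℝ => ENNReal.ofReal l * μ {x | l ≤ permitValue C j x}) l

/-- Where the permit value `v` of `k` is below `r`, drop the overlap event. Where it is at least
`r`, independence and a union bound give at most `∑ v Pr[v_i ≥ v]` over `i ≠ k`; each term is the
revenue of posting `v` for permit `i`, so the sum is at most `r`. -/
theorem overlap_le_lintegral_min (hC : ∀ᵐ c ∂C, ∀ j, 0 ≤ c j) (k : ι) :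
    overlap D C k ≤ ∫⁻ x, min (ENNReal.ofReal (permitValue C k x))
      (∑ j, permitRevenue (D j) C j) ∂D k := by
  classical
  set r := ∑ j, permitRevenue (D j) C j with hr
  set v : ι → ℝ → ℝ≥0∞ := fun i x => ENNReal.ofReal (permitValue C i x) with hv
  have hpm : ∀ i, Measurable (permitValue C i) := fun i => (permitValue_monotone hC i).measurable
  have hvm : ∀ i, Measurable (v i) := fun i => (hpm i).ennreal_ofReal
  set H : Set ℝ := {x | r ≤ v k x} with hH
  have hHm : MeasurableSet H := measurableSet_le measurable_const (hvm k)
  set E : ι → Set (ι → ℝ) := fun i => {t | permitValue C k (t k) ≤ permitValue C i (t i)} with hE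
  have hEm : ∀ i, MeasurableSet (E i) := fun i =>
    measurableSet_le ((hpm k).comp (measurable_pi_apply k)) ((hpm i).comp (measurable_pi_apply i))
  have hSm : MeasurableSet
      {t : ι → ℝ | ∃ i, i ≠ k ∧ permitValue C k (t k) ≤ permitValue C i (t i)} := by
    have : {t : ι → ℝ | ∃ i, i ≠ k ∧ permitValue C k (t k) ≤ permitValue C i (t i)}
        = ⋃ i, ⋃ (_ : i ≠ k), E i := by
      ext t
      simp [hE]
    rw [this]
    exact MeasurableSet.iUnion fun i => MeasurableSet.iUnion fun _ => hEm i
  have hlow : Measurable fun x => Hᶜ.indicator (v k) x := (hvm k).indicator hHm.compl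
  have hhigh : Measurable fun x => H.indicator (v k) x := (hvm k).indicator hHm
  have hpair : ∀ i, i ≠ k →
      ∫⁻ t, (E i).indicator (fun t => H.indicator (v k) (t k)) t ∂Measure.pi D
        ≤ permitRevenue (D i) C i * D k H := by
    intro i hi
    have hfm : Measurable fun t : ι → ℝ => (E i).indicator (fun t => H.indicator (v k) (t k)) t :=
      (hhigh.comp (measurable_pi_apply k)).indicator (hEm i)
    have hgm : Measurable fun t : ι → ℝ => H.indicator (fun _ => permitRevenue (D i) C i) (t k) :=
      (measurable_const.indicator hHm).comp (measurable_pi_apply k)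
    refine (lintegral_le_of_lmarginal_le {i} hfm hgm fun t => ?_).trans (le_of_eq ?_)
    · rw [lmarginal_singleton, lmarginal_singleton]
      simp only [Function.update_of_ne hi.symm, lintegral_const, measure_univ, mul_one]
      by_cases hx : t k ∈ H
      · rw [Set.indicator_of_mem hx]
        have e : ∀ s, (E i).indicator (fun t => H.indicator (v k) (t k)) (Function.update t i s)
            = {s | permitValue C k (t k) ≤ permitValue C i s}.indicator
              (fun _ => v k (t k)) s := by
          intro s
          simp only [hE, Set.indicator_apply, Set.mem_ofPred_eq, Function.update_of_ne hi.symm,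
            Function.update_self, if_pos hx]
        simp_rw [e]
        rw [lintegral_indicator (measurableSet_le measurable_const (hpm i)), setLIntegral_const]
        exact ofReal_mul_measure_permit_le (D i) i _
      · rw [Set.indicator_of_notMem hx]
        simp only [Set.indicator_apply, Function.update_of_ne hi.symm, if_neg hx, ite_self,
          lintegral_zero, le_refl]
    · refine ((measurePreserving_eval D k).lintegral_comp
        (measurable_const.indicator hHm)).trans ?_
      rw [lintegral_indicator hHm, setLIntegral_const]
  calc overlap D C k
      ≤ ∫⁻ t, (Hᶜ.indicator (v k) (t k) + ∑ i ∈ Finset.univ.erase k,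
          (E i).indicator (fun t => H.indicator (v k) (t k)) t) ∂Measure.pi D := by
        rw [overlap, ← lintegral_indicator hSm]
        refine lintegral_mono fun t => ?_
        by_cases ht : t ∈ {t : ι → ℝ | ∃ i, i ≠ k ∧ permitValue C k (t k) ≤ permitValue C i (t i)}
        · rw [Set.indicator_of_mem ht]
          obtain ⟨i, hi, hle⟩ := ht
          by_cases hx : t k ∈ H
          · refine le_add_left ?_
            refine le_trans ?_ (Finset.single_le_sum
              (f := fun i => (E i).indicator (fun t => H.indicator (v k) (t k)) t)
              (fun i _ => zero_le) (Finset.mem_erase.mpr ⟨hi, Finset.mem_univ i⟩))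
            simp only
            rw [Set.indicator_of_mem (by exact hle), Set.indicator_of_mem hx]
          · refine le_add_right ?_
            rw [Set.indicator_of_mem (by exact hx)]
        · rw [Set.indicator_of_notMem ht]
          exact zero_le
    _ = ∫⁻ x, Hᶜ.indicator (v k) x ∂D k + ∑ i ∈ Finset.univ.erase k,
          ∫⁻ t, (E i).indicator (fun t => H.indicator (v k) (t k)) t ∂Measure.pi D := by
        have hlow' : Measurable fun t : ι → ℝ => Hᶜ.indicator (v k) (t k) :=
          hlow.comp (measurable_pi_apply k)
        have hhigh' : Measurable fun t : ι → ℝ => H.indicator (v k) (t k) :=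
          hhigh.comp (measurable_pi_apply k)
        rw [lintegral_add_left hlow',
          lintegral_finsetSum _ fun i _ => hhigh'.indicator (hEm i)]
        congr 1
        exact (measurePreserving_eval D k).lintegral_comp hlow
    _ ≤ ∫⁻ x, Hᶜ.indicator (v k) x ∂D k + r * D k H := by
        gcongr
        refine (Finset.sum_le_sum fun i hi => hpair i (Finset.ne_of_mem_erase hi)).trans ?_
        rw [← Finset.sum_mul]
        gcongr
        exact Finset.sum_le_sum_of_subset (Finset.erase_subset k Finset.univ)
    _ = ∫⁻ x, (Hᶜ.indicator (v k) x + H.indicator (fun _ => r) x) ∂D k := by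
        rw [lintegral_add_left hlow, lintegral_indicator hHm, setLIntegral_const]
    _ ≤ _ := by
        refine lintegral_mono fun x => ?_
        by_cases hx : x ∈ H
        · rw [Set.indicator_of_notMem (by simpa using hx), Set.indicator_of_mem hx, zero_add]
          exact le_min hx le_rfl
        · rw [Set.indicator_of_mem (by exact hx), Set.indicator_of_notMem hx, add_zero]
          exact le_min le_rfl (not_le.mp hx).le

theorem sum_overlap_le (hC : ∀ᵐ c ∂C, ∀ j, 0 ≤ c j) [Nonempty ι] :
    ∑ k, overlap D C k
      ≤ ENNReal.ofReal (1 + Real.log (Fintype.card ι)) * ∑ j, permitRevenue (D j) C j := by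
  set r := ∑ j, permitRevenue (D j) C j with hr
  have hm : (1 : ℝ) ≤ Fintype.card ι := by exact_mod_cast Fintype.card_pos
  have hlog : 0 ≤ Real.log (Fintype.card ι) := Real.log_nonneg hm
  rcases eq_or_ne r ⊤ with htop | htop
  · rw [htop, ENNReal.mul_top]
    · exact le_top
    · simp only [ne_eq, ENNReal.ofReal_eq_zero, not_le]
      linarith
  rcases eq_or_ne r 0 with h0 | h0
  · refine le_of_eq_of_le (Finset.sum_eq_zero fun k _ => ?_) zero_le
    have := overlap_le_lintegral_min (D := D) hC k
    rw [← hr, h0] at this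
    simpa using this
  have hb : 0 < r.toReal := ENNReal.toReal_pos h0 htop
  have hk : ∀ k, overlap D C k ≤ ENNReal.ofReal (r.toReal / Fintype.card ι)
      + ENNReal.ofReal (Real.log (Fintype.card ι)) * permitRevenue (D k) C k := by
    intro k
    have h1 := overlap_le_lintegral_min (D := D) hC k
    rw [← hr, ← ENNReal.ofReal_toReal htop] at h1
    exact h1.trans (lintegral_min_le (permitValue_monotone hC k).measurable
      (fun x => permitValue_nonneg k x) (ofReal_mul_measure_permit_le (D k) k) hb hm)
  refine (Finset.sum_le_sum fun k _ => hk k).trans (le_of_eq ?_)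
  rw [Finset.sum_add_distrib, ← Finset.mul_sum, ← hr, Finset.sum_const, Finset.card_univ,
    ENNReal.ofReal_add zero_le_one hlog, add_mul, ENNReal.ofReal_one, one_mul]
  congr 1
  rw [nsmul_eq_mul, ← ENNReal.ofReal_natCast, ← ENNReal.ofReal_mul (by linarith),
    mul_div_cancel₀ _ (by linarith), ENNReal.ofReal_toReal htop]

theorem overlap_eq_zero [Subsingleton ι] (k : ι) : overlap D C k = 0 := by
  have : {t : ι → ℝ | ∃ i, i ≠ k ∧ permitValue C k (t k) ≤ permitValue C i (t i)} = ∅ := by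
    ext t
    simp only [Set.mem_ofPred_eq, Set.mem_empty_iff_false, iff_false, not_exists]
    exact fun i h => h.1 (Subsingleton.elim i k)
  rw [overlap, this, Measure.restrict_empty, lintegral_zero_measure]

theorem sum_overlap_le_log (hC : ∀ᵐ c ∂C, ∀ j, 0 ≤ c j) [Nonempty ι] :
    ∑ k, overlap D C k
      ≤ ENNReal.ofReal (3 * Real.log (Fintype.card ι)) * ∑ j, permitRevenue (D j) C j := by
  rcases subsingleton_or_nontrivial ι with h | h
  · simp [overlap_eq_zero]
  · refine (sum_overlap_le hC).trans ?_
    gcongr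
    have h2 : (2 : ℝ) ≤ Fintype.card ι := by exact_mod_cast Fintype.one_lt_card (α := ι)
    have := Real.log_le_log (by norm_num) h2
    linarith [Real.log_two_gt_d9]

end

/-! ### The ironed revenue curve -/

section Myerson

variable {μ : Measure ℝ} [IsProbabilityMeasure μ]

theorem priceAt_set_nonempty_of_nonneg (hμ : ∀ᵐ x ∂μ, 0 ≤ x) {q : ℝ} (hq : q ≤ 1) :
    (0 : ℝ) ∈ {v : ℝ | q ≤ μ.real (Set.Ici v)} := by
  have h : μ (Set.Ici 0) = 1 := (mem_ae_iff_prob_eq_one measurableSet_Ici).mp hμ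
  simpa [measureReal_def, h] using hq

theorem le_tail_priceAt_of_nonneg (hμ : ∀ᵐ x ∂μ, 0 ≤ x) {q : ℝ} (hq : q ≤ 1) :
    q ≤ μ.real (Set.Ici (priceAt μ q)) :=
  le_tail_priceAt ⟨0, priceAt_set_nonempty_of_nonneg hμ hq⟩

theorem priceAt_nonneg (hμ : ∀ᵐ x ∂μ, 0 ≤ x) {q : ℝ} (hq : q ∈ Set.Ioc (0 : ℝ) 1) :
    0 ≤ priceAt μ q :=
  le_priceAt hq.1 (priceAt_set_nonempty_of_nonneg hμ hq.2)

theorem priceAt_le_of_le (hμ : ∀ᵐ x ∂μ, 0 ≤ x) {x y : ℝ} (hx : 0 < x) (hxy : x ≤ y)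
    (hy : y ≤ 1) : priceAt μ y ≤ priceAt μ x :=
  le_priceAt hx (hxy.trans (le_tail_priceAt_of_nonneg hμ hy))

theorem revenueCurve_nonneg (hμ : ∀ᵐ x ∂μ, 0 ≤ x) {q : ℝ} (hq : q ∈ Set.Icc (0 : ℝ) 1) :
    0 ≤ revenueCurve μ q := by
  rcases hq.1.eq_or_lt with rfl | hpos
  · simp [revenueCurve]
  · exact mul_nonneg hpos.le (priceAt_nonneg hμ ⟨hpos, hq.2⟩)

/-- Prices above a suitable `V` earn at most `ε`, and lower prices earn at most `V q`. This affine
majorant makes the ironed curve finite and forces it to `0` at `0+`. -/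
theorem exists_revenueCurve_le (hμ : ∀ᵐ x ∂μ, 0 ≤ x)
    (hlim : Tendsto (fun v : ℝ => v * μ.real (Set.Ici v)) atTop (𝓝 0)) {ε : ℝ} (hε : 0 < ε) :
    ∃ V : ℝ, 0 ≤ V ∧ ∀ q ∈ Set.Icc (0 : ℝ) 1, revenueCurve μ q ≤ ε + V * q := by
  obtain ⟨V, hV⟩ := eventually_atTop.mp (hlim.eventually_lt_const hε)
  refine ⟨max V 0, le_max_right _ _, fun q hq => ?_⟩
  have hV0 : 0 ≤ max V 0 * q := mul_nonneg (le_max_right _ _) hq.1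
  rcases hq.1.eq_or_lt with rfl | hpos
  · simpa [revenueCurve] using hε.le
  · rcases le_total (max V 0) (priceAt μ q) with h | h
    · have h1 := hV _ ((le_max_left _ _).trans h)
      have h2 := mul_le_mul_of_nonneg_right (le_tail_priceAt_of_nonneg hμ hq.2)
        ((le_max_right V 0).trans h)
      rw [revenueCurve]
      linarith
    · have := mul_le_mul_of_nonneg_left h hpos.le
      rw [revenueCurve]
      linarith

/-- `g` is a concave majorant on `[0,1]` of the revenue curve. -/
def IsConcaveMajorant (μ : Measure ℝ) (g : ℝ → ℝ) : Prop :=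
  ConcaveOn ℝ (Set.Icc 0 1) g ∧ ∀ x ∈ Set.Icc (0 : ℝ) 1, revenueCurve μ x ≤ g x

theorem isConcaveMajorant_affine {a b : ℝ}
    (h : ∀ x ∈ Set.Icc (0 : ℝ) 1, revenueCurve μ x ≤ a + b * x) :
    IsConcaveMajorant μ fun x => a + b * x := by
  refine ⟨⟨convex_Icc 0 1, fun x _ y _ s t _ _ hst => le_of_eq ?_⟩, h⟩
  simp only [smul_eq_mul]
  linear_combination (a * hst)

theorem IsConcaveMajorant.ironedRevenueCurve_le {g : ℝ → ℝ} (hg : IsConcaveMajorant μ g) {q : ℝ}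
    (hq : q ∈ Set.Icc (0 : ℝ) 1) : ironedRevenueCurve μ q ≤ g q := by
  refine csInf_le ⟨revenueCurve μ q, ?_⟩ ⟨g, hg.1, hg.2, rfl⟩
  rintro _ ⟨g', -, hg', rfl⟩
  exact hg' q hq

theorem revenueCurve_le_ironed (hex : ∃ g, IsConcaveMajorant μ g) {q : ℝ}
    (hq : q ∈ Set.Icc (0 : ℝ) 1) : revenueCurve μ q ≤ ironedRevenueCurve μ q := by
  obtain ⟨g, hg⟩ := hex
  refine le_csInf ⟨g q, g, hg.1, hg.2, rfl⟩ ?_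
  rintro _ ⟨g', -, hg', rfl⟩
  exact hg' q hq

theorem concaveOn_ironed (hex : ∃ g, IsConcaveMajorant μ g) :
    ConcaveOn ℝ (Set.Icc 0 1) (ironedRevenueCurve μ) := by
  refine ⟨convex_Icc 0 1, fun x hx y hy a b ha hb hab => ?_⟩
  obtain ⟨g, hg⟩ := hex
  refine le_csInf ⟨g _, g, hg.1, hg.2, rfl⟩ ?_
  rintro _ ⟨g', hc, hg', rfl⟩
  refine le_trans ?_ (hc.2 hx hy ha hb hab)
  have h1 := IsConcaveMajorant.ironedRevenueCurve_le ⟨hc, hg'⟩ hx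
  have h2 := IsConcaveMajorant.ironedRevenueCurve_le ⟨hc, hg'⟩ hy
  simp only [smul_eq_mul]
  gcongr

/-- The ironed revenue curve is affine where the quantile function is constant. -/
theorem ironed_eq_affine (hμ : ∀ᵐ x ∂μ, 0 ≤ x) (hex : ∃ g, IsConcaveMajorant μ g) {a b : ℝ}
    (ha : 0 < a) (hab : a < b) (hb : b ≤ 1) (hconst : priceAt μ a = priceAt μ b) :
    ∀ x ∈ Set.Icc a b, ironedRevenueCurve μ x = ironedRevenueCurve μ a +
      (ironedRevenueCurve μ b - ironedRevenueCurve μ a) / (b - a) * (x - a) := by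
  have hconc := concaveOn_ironed hex
  set f := ironedRevenueCurve μ with hf
  set s := (f b - f a) / (b - a) with hs
  have hpos : 0 < b - a := by linarith
  have hsb : s * (b - a) = f b - f a := div_mul_cancel₀ _ hpos.ne'
  have ham : a ∈ Set.Icc (0 : ℝ) 1 := ⟨ha.le, by linarith⟩
  have hbm : b ∈ Set.Icc (0 : ℝ) 1 := ⟨by linarith, hb⟩
  have hline : ConcaveOn ℝ (Set.Icc (0 : ℝ) 1) fun x => f a + s * (x - a) := by
    refine ⟨convex_Icc 0 1, fun x _ y _ c d _ _ hcd => le_of_eq ?_⟩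
    simp only [smul_eq_mul]
    linear_combination ((f a - s * a) * hcd)
  -- Cutting `f` by the line through its values at `a` and `b` leaves a majorant. Outside `[a, b]`
  -- concavity puts `f` below that line; inside, the revenue curve is linear and lies below `f` at
  -- both ends. Minimality then puts `f` below the chord.
  have hmaj : IsConcaveMajorant μ (f ⊓ fun x => f a + s * (x - a)) := by
    refine ⟨hconc.inf hline, fun x hx => le_inf (revenueCurve_le_ironed hex hx) ?_⟩
    have hle := revenueCurve_le_ironed hex hx
    rcases lt_or_ge x a with hxa | hxa
    · have h1 := hconc.slope_anti_adjacent hx hbm hxa hab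
      rw [← hs, le_div_iff₀ (by linarith)] at h1
      linarith
    rcases lt_or_ge b x with hbx | hbx
    · have h1 := hconc.slope_anti_adjacent ham hx hab hbx
      rw [← hs, div_le_iff₀ (by linarith)] at h1
      linarith
    · have hpx : priceAt μ x = priceAt μ a :=
        le_antisymm (priceAt_le_of_le hμ ha hxa hx.2)
          (hconst.trans_le (priceAt_le_of_le hμ (by linarith) hbx hb))
      have h1 := revenueCurve_le_ironed hex ham
      have h2 := revenueCurve_le_ironed hex hbm
      rw [revenueCurve] at h1 h2 ⊢
      rw [hpx]
      rw [← hconst] at h2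
      have e : (b - a) * (f a + s * (x - a) - x * priceAt μ a)
          = (b - x) * (f a - a * priceAt μ a) + (x - a) * (f b - b * priceAt μ a) := by
        linear_combination (x - a) * hsb
      have h3 : 0 ≤ (b - a) * (f a + s * (x - a) - x * priceAt μ a) := by
        rw [e]
        exact add_nonneg (mul_nonneg (by linarith) (by linarith))
          (mul_nonneg (by linarith) (by linarith))
      linarith [nonneg_of_mul_nonneg_right h3 hpos]
  intro x hx
  have hxm : x ∈ Set.Icc (0 : ℝ) 1 := ⟨ham.1.trans hx.1, hx.2.trans hb⟩
  refine le_antisymm ((hmaj.ironedRevenueCurve_le hxm).trans inf_le_right) ?_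
  rcases hx.1.eq_or_lt with rfl | hax
  · simp
  rcases hx.2.eq_or_lt with rfl | hxb
  · linarith
  have h1 := hconc.slope_anti_adjacent ham hbm hax hxb
  rw [div_le_div_iff₀ (by linarith) (by linarith)] at h1
  have e : (b - a) * (f x - (f a + s * (x - a)))
      = (f x - f a) * (b - x) - (f b - f x) * (x - a) := by
    linear_combination (-(x - a)) * hsb
  have h3 : 0 ≤ (b - a) * (f x - (f a + s * (x - a))) := by rw [e]; linarith
  linarith [nonneg_of_mul_nonneg_right h3 hpos]

/-! ### The derivative of the ironed revenue curve. -/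

/-- The slope of the ironed revenue curve to the left of a quantile. -/
def ironedSlope (μ : Measure ℝ) (q : ℝ) : ℝ :=
  derivWithin (ironedRevenueCurve μ) (Set.Iio q) q

/-- Reflection turns left derivatives into right derivatives. -/
theorem measurable_ironedSlope (μ : Measure ℝ) : Measurable (ironedSlope μ) := by
  have h := measurable_derivWithin_Ioi fun y : ℝ => ironedRevenueCurve μ (-y)
  have e : ironedSlope μ = fun q =>
      -derivWithin (fun y : ℝ => ironedRevenueCurve μ (-y)) (Set.Ioi (-q)) (-q) := by
    funext q
    rw [derivWithin_comp_neg]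
    simp [ironedSlope]
  rw [e]
  exact (h.comp measurable_neg).neg

theorem ironedSlope_eq_of_const (hμ : ∀ᵐ x ∂μ, 0 ≤ x) (hex : ∃ g, IsConcaveMajorant μ g)
    {a b q : ℝ} (ha : 0 < a) (hb : b ≤ 1) (hconst : priceAt μ a = priceAt μ b)
    (hq : q ∈ Set.Ioc a b) :
    ironedSlope μ q = (ironedRevenueCurve μ b - ironedRevenueCurve μ a) / (b - a) := by
  have haff := ironed_eq_affine hμ hex ha (hq.1.trans_le hq.2) hb hconst
  set s := (ironedRevenueCurve μ b - ironedRevenueCurve μ a) / (b - a) with hs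
  have hd : HasDerivWithinAt (fun x => ironedRevenueCurve μ a + s * (x - a)) s (Set.Iio q) q := by
    have := (((hasDerivAt_id q).sub_const a).const_mul s).const_add (ironedRevenueCurve μ a)
    simpa using this.hasDerivWithinAt
  refine (hd.congr_of_eventuallyEq ?_ (haff q ⟨hq.1.le, hq.2⟩)).derivWithin
    (uniqueDiffWithinAt_Iio q)
  filter_upwards [Ioo_mem_nhdsLT hq.1] with x hx
  exact haff x ⟨hx.1.le, hx.2.le.trans hq.2⟩

/-- The virtual value at `priceAt μ q` is the slope at `b q`, the right end of the interval where
the price is constant. Slopes at `q` and `b q` agree unless `q < b q` and `q` is the left end of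
that interval. Such `q` are countable, as the intervals `(q, b q)` are disjoint. -/
theorem ironedSlope_tail_priceAt_ae (hμ : ∀ᵐ x ∂μ, 0 ≤ x) (hex : ∃ g, IsConcaveMajorant μ g) :
    ∀ᵐ q ∂volume.restrict (Set.Ioo (0 : ℝ) 1),
      ironedVirtualValue μ (priceAt μ q) = ironedSlope μ q := by
  set b : ℝ → ℝ := fun q => μ.real (Set.Ici (priceAt μ q)) with hb
  set bad : Set ℝ := {q | q ∈ Set.Ioo (0 : ℝ) 1 ∧ q < b q ∧ ∀ x ∈ Set.Ioo 0 q,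
    priceAt μ x ≠ priceAt μ q} with hbad
  have hcount : bad.Countable := by
    have hkey : ∀ q1 ∈ bad, ∀ q2 ∈ bad, q1 < q2 →
        Disjoint (Set.Ioo q1 (b q1)) (Set.Ioo q2 (b q2)) := by
      intro q1 h1 q2 h2 hlt
      rw [Set.disjoint_left]
      intro x hx1 hx2
      refine h2.2.2 q1 ⟨h1.1.1, hlt⟩ (le_antisymm ?_ ?_)
      · exact le_priceAt h2.1.1 (hx2.1.trans hx1.2).le
      · exact priceAt_antitoneOn μ h1.1 h2.1 hlt.le
    refine Set.PairwiseDisjoint.countable_of_Ioo (y := b) ?_ fun q hq => hq.2.1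
    intro q1 h1 q2 h2 hne
    rcases lt_or_gt_of_ne hne with h | h
    · exact hkey q1 h1 q2 h2 h
    · exact (hkey q2 h2 q1 h1 h).symm
  have hnull : ∀ᵐ q ∂volume.restrict (Set.Ioo (0 : ℝ) 1), q ∉ bad :=
    ae_restrict_of_ae (hcount.ae_notMem volume)
  filter_upwards [hnull, ae_restrict_mem measurableSet_Ioo] with q hq hq01
  have hqb : q ≤ b q := (le_priceAt_iff hq01).mp le_rfl
  change ironedSlope μ (b q) = ironedSlope μ q
  rcases hqb.eq_or_lt with heq | hlt
  · rw [← heq]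
  · have hx : ∃ x ∈ Set.Ioo 0 q, priceAt μ x = priceAt μ q := by
      by_contra! hcon
      exact hq ⟨hq01, hlt, hcon⟩
    obtain ⟨x, hx, hxq⟩ := hx
    have hb1 : b q ≤ 1 := tail_le_one _
    have hbq : priceAt μ (b q) = priceAt μ q :=
      le_antisymm (priceAt_le_of_le hμ hq01.1 hqb hb1) (le_priceAt (hq01.1.trans hlt) le_rfl)
    have hc : priceAt μ x = priceAt μ (b q) := hxq.trans hbq.symm
    rw [ironedSlope_eq_of_const hμ hex hx.1 hb1 hc ⟨hx.2.trans hlt, le_rfl⟩,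
      ironedSlope_eq_of_const hμ hex hx.1 hb1 hc ⟨hx.2, hqb⟩]

theorem hasDerivWithinAt_ironed (hex : ∃ g, IsConcaveMajorant μ g)
    {q : ℝ} (hq : q ∈ Set.Ioo (0 : ℝ) 1) :
    HasDerivWithinAt (ironedRevenueCurve μ) (ironedSlope μ q) (Set.Iio q) q := by
  have h := (concaveOn_ironed hex).neg.differentiableWithinAt_Iio_of_mem_interior
    (x := q) (by rwa [interior_Icc])
  have h' : DifferentiableWithinAt ℝ (ironedRevenueCurve μ) (Set.Iio q) q := by
    simpa using h.neg
  exact h'.hasDerivWithinAt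

/-- Together with `ironed_sub_le`, this says that the left derivative is a supergradient of the
ironed curve, up to the closed endpoints of `[0, 1]`. -/
theorem mul_ironedSlope_le (hex : ∃ g, IsConcaveMajorant μ g)
    {x q : ℝ} (hx : 0 ≤ x) (hxq : x ≤ q) (hq : q ∈ Set.Ioo (0 : ℝ) 1) :
    (q - x) * ironedSlope μ q ≤ ironedRevenueCurve μ q - ironedRevenueCurve μ x := by
  rcases hxq.eq_or_lt with rfl | hlt
  · simp
  have h := (concaveOn_ironed hex).le_slope_of_hasDerivWithinAt_Iio (x := x) (y := q)
    ⟨hx, hlt.le.trans hq.2.le⟩ ⟨hq.1.le, hq.2.le⟩ hlt (hasDerivWithinAt_ironed hex hq)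
  rwa [slope_def_field, le_div_iff₀' (by linarith)] at h

theorem ironed_sub_le (hex : ∃ g, IsConcaveMajorant μ g)
    {q y : ℝ} (hq : q ∈ Set.Ioo (0 : ℝ) 1) (hqy : q ≤ y) (hy : y ≤ 1) :
    ironedRevenueCurve μ y - ironedRevenueCurve μ q ≤ (y - q) * ironedSlope μ q := by
  rcases hqy.eq_or_lt with rfl | hlt
  · simp
  have hlim := (hasDerivWithinAt_iff_tendsto_slope' Set.self_notMem_Iio).mp
    (hasDerivWithinAt_ironed hex hq)
  rw [← div_le_iff₀' (by linarith)]
  refine ge_of_tendsto hlim ?_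
  filter_upwards [Ioo_mem_nhdsLT hq.1] with x hx
  have h := (concaveOn_ironed hex).slope_anti_adjacent (x := x) (y := q) (z := y)
    ⟨hx.1.le, hx.2.le.trans hq.2.le⟩ ⟨hq.1.le.trans hqy, hy⟩ hx.2 hlt
  rw [slope_comm, slope_def_field]
  exact h

theorem ironedSlope_antitoneOn (hex : ∃ g, IsConcaveMajorant μ g) : AntitoneOn (ironedSlope μ) (Set.Ioo 0 1) := by
  intro x hx y hy hxy
  rcases hxy.eq_or_lt with rfl | hlt
  · exact le_rfl
  have h1 := mul_ironedSlope_le hex hx.1.le hxy hy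
  have h2 := ironed_sub_le hex hx hxy hy.2.le
  exact le_of_mul_le_mul_left (h1.trans h2) (by linarith)

theorem intervalIntegrable_ironedSlope (hex : ∃ g, IsConcaveMajorant μ g)
    {a b : ℝ} (ha : 0 < a) (hab : a ≤ b) (hb : b < 1) :
    IntervalIntegrable (ironedSlope μ) volume a b := by
  refine ((ironedSlope_antitoneOn hex).mono ?_).intervalIntegrable
  rw [Set.uIcc_of_le hab]
  exact fun x hx => ⟨ha.trans_le hx.1, hx.2.trans_lt hb⟩

/-- Increments of the integral and of the curve both lie between `(y - x) h(y)` and `(y - x) h(x)`,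
with `h` the slope. `le_of_sub_le_mul_sub` with `Θ = -h`, applied to both differences, gives
equality without differentiability. -/
theorem integral_ironedSlope (hex : ∃ g, IsConcaveMajorant μ g)
    {a b : ℝ} (ha : 0 < a) (hab : a ≤ b) (hb : b < 1) :
    ∫ y in a..b, ironedSlope μ y = ironedRevenueCurve μ b - ironedRevenueCurve μ a := by
  set h := ironedSlope μ with hh
  have hanti := ironedSlope_antitoneOn hex
  have hmem : ∀ x, a ≤ x → x ≤ b → x ∈ Set.Ioo (0 : ℝ) 1 := fun x h1 h2 =>
    ⟨ha.trans_le h1, h2.trans_lt hb⟩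
  have hint : ∀ x y, a ≤ x → x ≤ y → y ≤ b → IntervalIntegrable h volume x y :=
    fun x y h1 h2 h3 =>
      intervalIntegrable_ironedSlope hex (ha.trans_le h1) h2 (h3.trans_lt hb)
  have hsplit : ∀ x y, a ≤ x → x ≤ y → y ≤ b →
      (∫ z in a..y, h z) - ∫ z in a..x, h z = ∫ z in x..y, h z := fun x y h1 h2 h3 =>
    intervalIntegral.integral_interval_sub_left (hint a y le_rfl (h1.trans h2) h3)
      (hint a x le_rfl h1 (h2.trans h3))
  have hlow : ∀ x y, a ≤ x → x ≤ y → y ≤ b → (y - x) * h y ≤ ∫ z in x..y, h z := by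
    intro x y h1 h2 h3
    have := intervalIntegral.integral_mono_on h2 intervalIntegrable_const (hint x y h1 h2 h3)
      (f := fun _ => h y) fun z hz => hanti (hmem z (h1.trans hz.1) (hz.2.trans h3))
        (hmem y (h1.trans h2) h3) hz.2
    simpa using this
  have hupp : ∀ x y, a ≤ x → x ≤ y → y ≤ b → ∫ z in x..y, h z ≤ (y - x) * h x := by
    intro x y h1 h2 h3
    have := intervalIntegral.integral_mono_on h2 (hint x y h1 h2 h3) intervalIntegrable_const
      (g := fun _ => h x) fun z hz => hanti (hmem x h1 (h2.trans h3))
        (hmem z (h1.trans hz.1) (hz.2.trans h3)) hz.1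
    simpa using this
  have hA := le_of_sub_le_mul_sub (F := fun y => (∫ z in a..y, h z) - ironedRevenueCurve μ y)
    (Θ := fun y => -h y) hab (by
      intro x y h1 h2 h3
      have e1 := hsplit x y h1 h2 h3
      have e2 := hupp x y h1 h2 h3
      have e3 := mul_ironedSlope_le hex (ha.le.trans h1) h2 (hmem y (h1.trans h2) h3)
      nlinarith)
  have hB := le_of_sub_le_mul_sub (F := fun y => ironedRevenueCurve μ y - ∫ z in a..y, h z)
    (Θ := fun y => -h y) hab (by
      intro x y h1 h2 h3
      have e1 := hsplit x y h1 h2 h3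
      have e2 := hlow x y h1 h2 h3
      have e3 := ironed_sub_le hex (hmem x h1 (h2.trans h3)) h2 (h3.trans hb.le)
      nlinarith)
  simp only [intervalIntegral.integral_same] at hA hB
  linarith

theorem integral_ironedSlope_sub (hex : ∃ g, IsConcaveMajorant μ g)
    {a b : ℝ} (ha : 0 < a) (hab : a ≤ b) (hb : b < 1) (c : ℝ) :
    ∫ y in a..b, (ironedSlope μ y - c)
      = (ironedRevenueCurve μ b - c * b) - (ironedRevenueCurve μ a - c * a) := by
  rw [intervalIntegral.integral_sub (intervalIntegrable_ironedSlope hex ha hab hb)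
    intervalIntegrable_const, integral_ironedSlope hex ha hab hb,
    intervalIntegral.integral_const, smul_eq_mul]
  ring

/-! ### Myerson's formula for the optimal posted price -/

theorem postedProfit_le_lintegral (hμ : ∀ᵐ x ∂μ, 0 ≤ x)
    (hlim : Tendsto (fun v : ℝ => v * μ.real (Set.Ici v)) atTop (𝓝 0)) {c : ℝ} (hc : 0 ≤ c) :
    postedProfit μ c ≤ ∫⁻ q in Set.Ioo (0 : ℝ) 1, ENNReal.ofReal (ironedSlope μ q - c) := by
  have hmaj : ∀ ε : ℝ, 0 < ε → ∃ V : ℝ, 0 ≤ V ∧ IsConcaveMajorant μ fun x => ε + V * x := by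
    intro ε hε
    obtain ⟨V, hV, h⟩ := exists_revenueCurve_le hμ hlim hε
    exact ⟨V, hV, isConcaveMajorant_affine h⟩
  have hex : ∃ g, IsConcaveMajorant μ g := by
    obtain ⟨V, -, h⟩ := hmaj 1 one_pos
    exact ⟨_, h⟩
  have hconc := concaveOn_ironed hex
  refine iSup_le fun p => ?_
  set L := ∫⁻ q in Set.Ioo (0 : ℝ) 1, ENNReal.ofReal (ironedSlope μ q - c) with hL
  rcases le_or_gt p c with hpc | hpc
  · rw [ENNReal.ofReal_of_nonpos (by linarith), zero_mul]
    exact zero_le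
  rcases eq_or_ne L ⊤ with htop | htop
  · rw [htop]
    exact le_top
  set q := μ.real (Set.Ici p) with hq
  rw [← ofReal_measureReal (measure_ne_top μ (Set.Ici p)), ← ENNReal.ofReal_mul (by linarith),
    ← hq, ENNReal.ofReal_le_iff_le_toReal htop]
  have hq1 : q ≤ 1 := tail_le_one p
  by_contra! hlt
  have hp : 0 < p - c := by linarith
  have hL0 : 0 ≤ L.toReal := ENNReal.toReal_nonneg
  have hlt' : L.toReal / (p - c) < q := by rwa [div_lt_iff₀' hp]
  -- Assuming the price `p` earns more than `L`, a quantile `b < q` still gives `(p - c) b > L` and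
  -- stays below `1`. Below, `a` is so small that the ironed curve at `a` is under the excess `δ`;
  -- integrating the slope minus `c` over `[a, b]` then exceeds `L`.
  obtain ⟨b, hb1, hbq⟩ := exists_between hlt'
  have hb0 : 0 < b := (div_nonneg hL0 hp.le).trans_lt hb1
  rw [div_lt_iff₀' hp] at hb1
  set δ := (p - c) * b - L.toReal with hδ
  have hδ0 : 0 < δ := by linarith
  obtain ⟨V, hV0, hV⟩ := hmaj (δ / 2) (by linarith)
  set a := min (b / 2) (δ / (4 * (V + 1))) with ha
  have hV1 : 0 < V + 1 := by linarith
  have ha0 : 0 < a := lt_min (by linarith) (by positivity)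
  have hab : a < b := (min_le_left _ _).trans_lt (by linarith)
  have hVa : V * a < δ / 2 := by
    have h1 : a ≤ δ / (4 * (V + 1)) := min_le_right _ _
    rw [le_div_iff₀ (by linarith)] at h1
    nlinarith
  have hb1' : b < 1 := hbq.trans_le hq1
  have hq0 : 0 < q := hb0.trans hbq
  have h1 := integral_ironedSlope_sub hex ha0 hab.le hb1' c
  have h2 : ∫ y in a..b, (ironedSlope μ y - c) ≤ L.toReal := by
    rw [intervalIntegral.integral_of_le hab.le, ← ENNReal.ofReal_le_iff_le_toReal htop]
    refine ofReal_integral_le_lintegral_ofReal.trans (lintegral_mono_set ?_)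
    exact fun x hx => ⟨ha0.trans hx.1, hx.2.trans_lt hb1'⟩
  have h3 : ironedRevenueCurve μ a ≤ δ / 2 + V * a :=
    hV.ironedRevenueCurve_le ⟨ha0.le, (hab.trans hb1').le⟩
  have h4 : q * p ≤ ironedRevenueCurve μ q := by
    refine le_trans ?_ (revenueCurve_le_ironed hex ⟨hq0.le, hq1⟩)
    exact mul_le_mul_of_nonneg_left (le_priceAt hq0 le_rfl) hq0.le
  have h5 : 0 ≤ ironedRevenueCurve μ 0 :=
    (revenueCurve_nonneg hμ ⟨le_rfl, zero_le_one⟩).trans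
      (revenueCurve_le_ironed hex ⟨le_rfl, zero_le_one⟩)
  have h6 : b * p ≤ ironedRevenueCurve μ b := by
    have hw : 0 ≤ 1 - b / q := by
      rw [sub_nonneg, div_le_one hq0]
      exact hbq.le
    have := hconc.2 (x := 0) (y := q) ⟨le_rfl, zero_le_one⟩ ⟨hq0.le, hq1⟩ hw
      (div_nonneg hb0.le hq0.le) (by ring)
    simp only [smul_eq_mul, mul_zero, zero_add, div_mul_cancel₀ b hq0.ne'] at this
    have h7 : b / q * (q * p) ≤ b / q * ironedRevenueCurve μ q :=
      mul_le_mul_of_nonneg_left h4 (div_nonneg hb0.le hq0.le)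
    have h8 : b / q * (q * p) = b * p := by field_simp
    have h9 := mul_nonneg hw h5
    linarith
  have h10 : 0 ≤ c * a := mul_nonneg hc ha0.le
  nlinarith

theorem lintegral_le_postedProfit (hμ : ∀ᵐ x ∂μ, 0 ≤ x) (hex : ∃ g, IsConcaveMajorant μ g)
    (c : ℝ) : ∫⁻ q in Set.Ioo (0 : ℝ) 1, ENNReal.ofReal (ironedSlope μ q - c)
      ≤ postedProfit μ c := by
  rcases eq_or_ne (postedProfit μ c) ⊤ with htop | htop
  · rw [htop]
    exact le_top
  set G := (postedProfit μ c).toReal with hG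
  have hG0 : 0 ≤ G := ENNReal.toReal_nonneg
  -- The best posted profit `G` bounds `R(x) - c x`, and an affine majorant passes to the ironed
  -- curve: ironing does not raise the optimum.
  have hmaj : IsConcaveMajorant μ fun x => G + c * x := by
    refine isConcaveMajorant_affine fun x hx => ?_
    rcases hx.1.eq_or_lt with rfl | hx0
    · simpa [revenueCurve] using hG0
    · rw [revenueCurve]
      rcases le_total c (priceAt μ x) with h | h
      · have h1 : (priceAt μ x - c) * μ.real (Set.Ici (priceAt μ x)) ≤ G := by
          rw [hG, ← ENNReal.ofReal_le_iff_le_toReal htop, ENNReal.ofReal_mul (by linarith),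
            ofReal_measureReal]
          exact le_iSup (fun p : ℝ => ENNReal.ofReal (p - c) * μ (Set.Ici p)) (priceAt μ x)
        have h2 := mul_le_mul_of_nonneg_left (le_tail_priceAt_of_nonneg hμ hx.2)
          (sub_nonneg.mpr h)
        linarith
      · nlinarith
  set S : Set ℝ := {y | y ∈ Set.Ioo (0 : ℝ) 1 ∧ c < ironedSlope μ y} with hS
  rcases S.eq_empty_or_nonempty with hemp | hne
  · rw [setLIntegral_congr_fun (g := fun _ => 0) measurableSet_Ioo, lintegral_zero]
    · exact zero_le
    · intro y hy
      refine ENNReal.ofReal_of_nonpos ?_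
      have : ¬ c < ironedSlope μ y := fun h => by
        have : y ∈ S := ⟨hy, h⟩
        rw [hemp] at this
        exact this
      linarith [not_lt.mp this]
  have hbdd : BddAbove S := ⟨1, fun y hy => hy.1.2.le⟩
  -- The slope is antitone, so `S` is an initial segment ending at `B`. On compact subintervals of
  -- `(0, B)` the integral telescopes, with a left-end contribution of favourable sign. An
  -- exhaustion of `(0, B)` gives the full integral.
  set B := sSup S with hB
  have hB1 : B ≤ 1 := csSup_le hne fun y hy => hy.1.2.le
  have hB0 : 0 < B := by
    obtain ⟨y, hy⟩ := hne
    exact hy.1.1.trans_le (le_csSup hbdd hy)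
  have hSmem : ∀ y, 0 < y → y < B → y ∈ S := by
    intro y h0 hy
    obtain ⟨z, hz, hyz⟩ := exists_lt_of_lt_csSup hne hy
    have hy1 : y ∈ Set.Ioo (0 : ℝ) 1 := ⟨h0, hyz.trans hz.1.2⟩
    exact ⟨hy1, hz.2.trans_le (ironedSlope_antitoneOn hex hy1 hz.1 hyz.le)⟩
  have hcompact : ∀ a b, 0 < a → a ≤ b → b < B →
      ∫⁻ q in Set.Icc a b, ENNReal.ofReal (ironedSlope μ q - c) ≤ postedProfit μ c := by
    intro a b ha hab hb
    have hb1 : b < 1 := hb.trans_le hB1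
    have hint : IntegrableOn (fun q => ironedSlope μ q - c) (Set.Ioc a b) := by
      rw [← intervalIntegrable_iff_integrableOn_Ioc_of_le hab]
      exact (intervalIntegrable_ironedSlope hex ha hab hb1).sub intervalIntegrable_const
    rw [← restrict_Ioc_eq_restrict_Icc, ← ofReal_integral_eq_lintegral_ofReal hint,
      ← intervalIntegral.integral_of_le hab, integral_ironedSlope_sub hex ha hab hb1,
      ENNReal.ofReal_le_iff_le_toReal htop, ← hG]
    · have h1 : ironedRevenueCurve μ b ≤ G + c * b :=
        hmaj.ironedRevenueCurve_le ⟨ha.le.trans hab, hb1.le⟩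
      have hSa := hSmem a ha (hab.trans_lt hb)
      have h2 := mul_ironedSlope_le hex le_rfl ha.le hSa.1
      have h3 : 0 ≤ ironedRevenueCurve μ 0 :=
        (revenueCurve_nonneg hμ ⟨le_rfl, zero_le_one⟩).trans
          (revenueCurve_le_ironed hex ⟨le_rfl, zero_le_one⟩)
      have h4 := mul_lt_mul_of_pos_left hSa.2 ha
      linarith
    · filter_upwards [ae_restrict_mem measurableSet_Ioc] with y hy
      exact sub_nonneg.mpr (hSmem y (ha.trans hy.1) (hy.2.trans_lt hb)).2.le
  have hlim : ∀ᶠ n : ℕ in atTop, ∫⁻ q in Set.Icc (B * (1 / ((n : ℝ) + 1)))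
      (B * (1 - 1 / ((n : ℝ) + 1))), ENNReal.ofReal (ironedSlope μ q - c)
        ∂volume.restrict (Set.Ioo 0 B) ≤ postedProfit μ c := by
    refine Eventually.of_forall fun n => ?_
    have hn : 0 < 1 / ((n : ℝ) + 1) := by positivity
    refine (lintegral_mono' (Measure.restrict_mono le_rfl Measure.restrict_le_self) le_rfl).trans ?_
    rcases le_total (B * (1 / ((n : ℝ) + 1))) (B * (1 - 1 / ((n : ℝ) + 1))) with h | h
    · exact hcompact _ _ (mul_pos hB0 hn) h (by nlinarith)
    · rcases h.eq_or_lt with h | h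
      · rw [h, Set.Icc_self]
        simp
      · rw [Set.Icc_eq_empty (not_le.mpr h)]
        simp
  have hn0 : Tendsto (fun n : ℕ => 1 / ((n : ℝ) + 1)) atTop (𝓝 0) :=
    tendsto_one_div_add_atTop_nhds_zero_nat
  have hcover : AECover (volume.restrict (Set.Ioo 0 B)) atTop fun n : ℕ =>
      Set.Icc (B * (1 / ((n : ℝ) + 1))) (B * (1 - 1 / ((n : ℝ) + 1))) := by
    refine aecover_Ioo_of_Icc ?_ ?_
    · simpa using hn0.const_mul B
    · simpa using (hn0.const_sub 1).const_mul B
  have hm : Measurable fun q => ENNReal.ofReal (ironedSlope μ q - c) :=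
    ((measurable_ironedSlope μ).sub_const c).ennreal_ofReal
  have hmain := le_of_tendsto
    (hcover.lintegral_tendsto_of_countably_generated hm.aemeasurable) hlim
  refine le_trans ?_ hmain
  rw [← setLIntegral_congr (Ioo_ae_eq_Ioc (μ := volume) (a := (0 : ℝ)) (b := B)).symm,
    ← lintegral_indicator measurableSet_Ioo, ← lintegral_indicator measurableSet_Ioc]
  refine lintegral_mono fun y => ?_
  by_cases hy : y ∈ Set.Ioo (0 : ℝ) 1
  · rw [Set.indicator_of_mem hy]
    by_cases hyB : y ≤ B
    · rw [Set.indicator_of_mem (show y ∈ Set.Ioc 0 B from ⟨hy.1, hyB⟩)]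
    · rw [ENNReal.ofReal_of_nonpos]
      · exact zero_le
      · by_contra! hcon
        exact hyB (le_csSup hbdd ⟨hy, by linarith⟩)
  · rw [Set.indicator_of_notMem hy]
    exact zero_le

/-- For fixed cost, the value is transported to the uniform quantile, where its virtual value is
almost everywhere the ironed slope; the two bounds on `postedProfit` then meet. -/
theorem singleProfit_eq (hμ : ∀ᵐ x ∂μ, 0 ≤ x)
    (hlim : Tendsto (fun v : ℝ => v * μ.real (Set.Ici v)) atTop (𝓝 0)) {ν : Measure ℝ}
    [IsProbabilityMeasure ν] (hν : ∀ᵐ c ∂ν, 0 ≤ c) :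
    singleProfit μ ν = ∫⁻ z, ENNReal.ofReal (ironedVirtualValue μ z.1 - z.2) ∂μ.prod ν := by
  have hex : ∃ g, IsConcaveMajorant μ g := by
    obtain ⟨V, -, h⟩ := exists_revenueCurve_le hμ hlim one_pos
    exact ⟨_, isConcaveMajorant_affine h⟩
  have hφ : Measurable (ironedVirtualValue μ) :=
    (measurable_ironedSlope μ).comp (tail_antitone μ).measurable
  have hm2 : Measurable fun z : ℝ × ℝ => ironedVirtualValue μ z.1 - z.2 :=
    (hφ.comp measurable_fst).sub measurable_snd
  rw [lintegral_prod_symm _ hm2.ennreal_ofReal.aemeasurable, singleProfit]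
  refine lintegral_congr_ae ?_
  filter_upwards [hν] with c hc
  have h1 : ∫⁻ x, ENNReal.ofReal (ironedVirtualValue μ x - c) ∂μ
      = ∫⁻ q in Set.Ioo (0 : ℝ) 1, ENNReal.ofReal (ironedSlope μ q - c) := by
    have hm : Measurable fun x => ENNReal.ofReal (ironedVirtualValue μ x - c) :=
      (hφ.sub_const c).ennreal_ofReal
    have e := lintegral_map' (μ := volume.restrict (Set.Ioo (0 : ℝ) 1)) hm.aemeasurable
      (aemeasurable_priceAt (μ := μ))
    rw [map_priceAt] at e
    rw [e]
    refine lintegral_congr_ae ?_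
    filter_upwards [ironedSlope_tail_priceAt_ae hμ hex] with q hq
    rw [hq]
  rw [h1]
  exact le_antisymm (postedProfit_le_lintegral hμ hlim hc) (lintegral_le_postedProfit hμ hex c)

end Myerson

/-! ### Comparison of the benchmarks -/

section Benchmarks

variable {ι : Type*} [Fintype ι] {D : ι → Measure ℝ} {C : Measure (ι → ℝ)}
  [∀ j, IsProbabilityMeasure (D j)] [IsProbabilityMeasure C]

theorem coe_sum_singleProfit_le {R : EReal} (hR0 : 0 ≤ R)
    (h : ∀ p : (ι → ℝ) → ι → ℝ, Measurable p → (∀ c j, c j ≤ p c j) →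
      profit D C (itemPricing p) ≤ R) :
    ((∑ j, singleProfit (D j) (C.map fun c => c j) : ℝ≥0∞) : EReal) ≤ R := by
  rw [← EReal.coe_toENNReal hR0, EReal.coe_ennreal_le_coe_ennreal_iff]
  refine sum_singleProfit_le fun p hp hcp => ?_
  have := EReal.toENNReal_le_toENNReal (h p hp hcp)
  rwa [profit_itemPricing hp hcp, EReal.toENNReal_coe] at this

theorem coe_sum_permitRevenue_le (hC : ∀ᵐ c ∂C, ∀ j, 0 ≤ c j) {R : EReal} (hR0 : 0 ≤ R)
    (h : ∀ l : ι → ℝ, profit D C (permitPricing C l) ≤ R) :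
    ((∑ j, permitRevenue (D j) C j : ℝ≥0∞) : EReal) ≤ R := by
  rw [← EReal.coe_toENNReal hR0, EReal.coe_ennreal_le_coe_ennreal_iff]
  refine sum_permitRevenue_le fun l hl => ?_
  have := EReal.toENNReal_le_toENNReal (h l)
  rwa [profit_permitPricing hC hl, EReal.toENNReal_coe] at this

theorem profit_itemPricing_nonneg : 0 ≤ profit D C (itemPricing fun c : ι → ℝ => c) := by
  rw [profit_itemPricing measurable_id' fun _ _ => le_rfl]
  exact EReal.coe_ennreal_nonneg _

theorem profit_permitPricing_nonneg (hC : ∀ᵐ c ∂C, ∀ j, 0 ≤ c j) :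
    0 ≤ profit D C (permitPricing C fun _ => 0) := by
  rw [profit_permitPricing hC fun _ => le_rfl]
  exact EReal.coe_ennreal_nonneg _

theorem optProfit_nonneg (hC : ∀ᵐ c ∂C, ∀ j, 0 ≤ c j) : 0 ≤ optProfit D C :=
  (profit_permitPricing_nonneg hC).trans
    (le_iSup₂ (f := fun (M : DirectMechanism ι) (_ : IsBICIR D C M) => profit D C M) _
      (isBICIR_permitPricing hC _))

theorem sum_singleProfit_le_ipProfit :
    ((∑ j, singleProfit (D j) (C.map fun c => c j) : ℝ≥0∞) : EReal) ≤ ipProfit D C := by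
  have hle : ∀ p : (ι → ℝ) → ι → ℝ, Measurable p →
      profit D C (itemPricing p) ≤ ipProfit D C := fun p hp =>
    le_iSup₂ (f := fun (p : (ι → ℝ) → ι → ℝ) (_ : Measurable p) =>
      profit D C (itemPricing p)) p hp
  exact coe_sum_singleProfit_le (profit_itemPricing_nonneg.trans (hle _ measurable_id'))
    fun p hp _ => hle p hp

theorem sum_singleProfit_le_optProfit (hC : ∀ᵐ c ∂C, ∀ j, 0 ≤ c j) :
    ((∑ j, singleProfit (D j) (C.map fun c => c j) : ℝ≥0∞) : EReal) ≤ optProfit D C :=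
  coe_sum_singleProfit_le (optProfit_nonneg hC) fun _ hp hcp =>
    le_iSup₂ (f := fun (M : DirectMechanism ι) (_ : IsBICIR D C M) => profit D C M) _
      (isBICIR_itemPricing hC hp hcp)

theorem sum_permitRevenue_le_ppProfit (hC : ∀ᵐ c ∂C, ∀ j, 0 ≤ c j) :
    ((∑ j, permitRevenue (D j) C j : ℝ≥0∞) : EReal) ≤ ppProfit D C := by
  have hle : ∀ l : ι → ℝ, profit D C (permitPricing C l) ≤ ppProfit D C := fun l =>
    le_iSup (fun l : ι → ℝ => profit D C (permitPricing C l)) l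
  exact coe_sum_permitRevenue_le hC ((profit_permitPricing_nonneg hC).trans (hle _)) hle

theorem sum_permitRevenue_le_optProfit (hC : ∀ᵐ c ∂C, ∀ j, 0 ≤ c j) :
    ((∑ j, permitRevenue (D j) C j : ℝ≥0∞) : EReal) ≤ optProfit D C :=
  coe_sum_permitRevenue_le hC (optProfit_nonneg hC) fun l =>
    le_iSup₂ (f := fun (M : DirectMechanism ι) (_ : IsBICIR D C M) => profit D C M) _
      (isBICIR_permitPricing hC l)

theorem optProfit_le_log [Nonempty ι] (hD : ∀ j, ∀ᵐ x ∂(D j), 0 ≤ x)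
    (hC : ∀ᵐ c ∂C, ∀ j, 0 ≤ c j) :
    optProfit D C ≤ ((∑ j, singleProfit (D j) (C.map fun c => c j) +
      ENNReal.ofReal (3 * Real.log (Fintype.card ι)) * ∑ j, permitRevenue (D j) C j : ℝ≥0∞) :
        EReal) := by
  refine (optProfit_le hD hC).trans ?_
  rw [EReal.coe_ennreal_le_coe_ennreal_iff]
  gcongr
  exact sum_overlap_le_log hC

end Benchmarks

/-! ### Markets with a single item for sale. -/

section Marginal

variable {ι : Type*} [Fintype ι] {D : ι → Measure ℝ} {C : Measure (ι → ℝ)}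
  [∀ j, IsProbabilityMeasure (D j)] [IsProbabilityMeasure C]

/-- The distribution of the cost of a single item, as a one-dimensional vector. -/
def costMarginal (C : Measure (ι → ℝ)) (j : ι) : Measure (({j} : Finset ι) → ℝ) :=
  C.map fun c (i : ({j} : Finset ι)) => c i

theorem measurable_restrictCost (j : ι) :
    Measurable fun (c : ι → ℝ) (i : ({j} : Finset ι)) => c i :=
  measurable_pi_iff.mpr fun i => measurable_pi_apply (i : ι)

instance isProbabilityMeasure_costMarginal (j : ι) : IsProbabilityMeasure (costMarginal C j) :=
  Measure.isProbabilityMeasure_map (measurable_restrictCost j).aemeasurable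

theorem costMarginal_nonneg (hC : ∀ᵐ c ∂C, ∀ j, 0 ≤ c j) (j : ι) :
    ∀ᵐ c ∂costMarginal C j, ∀ i, 0 ≤ c i := by
  rw [costMarginal, ae_map_iff (measurable_restrictCost j).aemeasurable]
  · filter_upwards [hC] with c hc i using hc i
  · have : {c : ({j} : Finset ι) → ℝ | ∀ i, 0 ≤ c i} = ⋂ i, {c | 0 ≤ c i} := by
      ext c
      simp
    rw [this]
    exact MeasurableSet.iInter fun i => measurableSet_le measurable_const (measurable_pi_apply i)

theorem costMarginal_map (j : ι) (i : ({j} : Finset ι)) :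
    (costMarginal C j).map (fun c => c i) = C.map fun c => c (i : ι) := by
  rw [costMarginal, Measure.map_map (measurable_pi_apply i) (measurable_restrictCost j)]
  rfl

theorem permitValue_costMarginal (j : ι) (i : ({j} : Finset ι)) (x : ℝ) :
    permitValue (costMarginal C j) i x = permitValue C (i : ι) x := by
  have hm : Measurable fun c : ({j} : Finset ι) → ℝ => max (x - c i) 0 :=
    (measurable_const.sub (measurable_pi_apply i)).max measurable_const
  rw [permitValue, costMarginal,
    integral_map (measurable_restrictCost j).aemeasurable hm.aestronglyMeasurable, permitValue]

theorem sum_singleProfit_costMarginal (j : ι) :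
    ∑ i : ({j} : Finset ι), singleProfit (D i) ((costMarginal C j).map fun c => c i)
      = singleProfit (D j) (C.map fun c => c j) := by
  simp_rw [costMarginal_map]
  rw [Finset.sum_coe_sort {j} fun i => singleProfit (D i) (C.map fun c => c i),
    Finset.sum_singleton]

theorem sum_permitRevenue_costMarginal (j : ι) :
    ∑ i : ({j} : Finset ι), permitRevenue (D i) (costMarginal C j) i
      = permitRevenue (D j) C j := by
  simp_rw [permitRevenue, permitValue_costMarginal]
  rw [Finset.sum_coe_sort {j} fun i => ⨆ l : ℝ, ENNReal.ofReal l * D i {x | l ≤ permitValue C i x},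
    Finset.sum_singleton]

theorem optProfitOn_singleton_eq (j : ι) :
    optProfitOn D C {j} = optProfit (fun i : ({j} : Finset ι) => D i) (costMarginal C j) := rfl

theorem optProfitOn_singleton_nonneg (hC : ∀ᵐ c ∂C, ∀ j, 0 ≤ c j) (j : ι) :
    0 ≤ optProfitOn D C {j} := by
  rw [optProfitOn_singleton_eq]
  exact optProfit_nonneg (costMarginal_nonneg hC j)

theorem singleProfit_le_optProfitOn (hC : ∀ᵐ c ∂C, ∀ j, 0 ≤ c j) (j : ι) :
    (singleProfit (D j) (C.map fun c => c j) : EReal) ≤ optProfitOn D C {j} := by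
  rw [← sum_singleProfit_costMarginal, optProfitOn_singleton_eq]
  exact sum_singleProfit_le_optProfit (costMarginal_nonneg hC j)

theorem permitRevenue_le_optProfitOn (hC : ∀ᵐ c ∂C, ∀ j, 0 ≤ c j) (j : ι) :
    (permitRevenue (D j) C j : EReal) ≤ optProfitOn D C {j} := by
  rw [← sum_permitRevenue_costMarginal, optProfitOn_singleton_eq]
  exact sum_permitRevenue_le_optProfit (costMarginal_nonneg hC j)

/-- With one item there is no competing permit, so the overlap vanishes and the general upper bound
meets posted pricing. -/
theorem optProfitOn_singleton (hD : ∀ j, ∀ᵐ x ∂(D j), 0 ≤ x) (hC : ∀ᵐ c ∂C, ∀ j, 0 ≤ c j)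
    (j : ι) : optProfitOn D C {j} = singleProfit (D j) (C.map fun c => c j) := by
  refine le_antisymm ?_ (singleProfit_le_optProfitOn hC j)
  rw [optProfitOn_singleton_eq, ← sum_singleProfit_costMarginal]
  have : Nonempty ({j} : Finset ι) := ⟨⟨j, Finset.mem_singleton_self j⟩⟩
  refine (optProfit_le (D := fun i : ({j} : Finset ι) => D i) (C := costMarginal C j)
    (fun i => hD i) (costMarginal_nonneg hC j)).trans (le_of_eq ?_)
  simp [overlap_eq_zero]

/-- The posted-price profit and the permit revenue of item `j` are each at most OPT({j}), hence the
factor `1 + a`. -/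
theorem coe_ofReal_mul_sum_le (hC : ∀ᵐ c ∂C, ∀ j, 0 ≤ c j) {a : ℝ} (ha : 0 ≤ a) :
    ((∑ j, singleProfit (D j) (C.map fun c => c j) +
      ENNReal.ofReal a * ∑ j, permitRevenue (D j) C j : ℝ≥0∞) : EReal)
        ≤ ((1 + a : ℝ) : EReal) * ∑ j, optProfitOn D C {j} := by
  set o : ι → ℝ≥0∞ := fun j => (optProfitOn D C {j}).toENNReal with ho
  have hcoe : ∀ j, optProfitOn D C {j} = o j := fun j =>
    (EReal.coe_toENNReal (optProfitOn_singleton_nonneg hC j)).symm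
  have hsum : ∑ j, optProfitOn D C {j} = ((∑ j, o j : ℝ≥0∞) : EReal) := by
    simp_rw [hcoe]
    have hs : ∀ s : Finset ι, ∑ j ∈ s, (o j : EReal) = ((∑ j ∈ s, o j : ℝ≥0∞) : EReal) := by
      classical
      intro s
      induction s using Finset.induction_on with
      | empty => simp
      | insert i s hi ih => rw [Finset.sum_insert hi, Finset.sum_insert hi, EReal.coe_ennreal_add, ih]
    exact hs Finset.univ
  have hreal : ((1 + a : ℝ) : EReal) = ((ENNReal.ofReal (1 + a) : ℝ≥0∞) : EReal) := by
    rw [EReal.coe_ennreal_ofReal, max_eq_left (by linarith)]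
  rw [hsum, hreal, ← EReal.coe_ennreal_mul, EReal.coe_ennreal_le_coe_ennreal_iff,
    ENNReal.ofReal_add zero_le_one ha, add_mul, ENNReal.ofReal_one, one_mul]
  have h1 : ∀ j, singleProfit (D j) (C.map fun c => c j) ≤ o j := fun j => by
    rw [← EReal.coe_ennreal_le_coe_ennreal_iff, ← hcoe]
    exact singleProfit_le_optProfitOn hC j
  have h2 : ∀ j, permitRevenue (D j) C j ≤ o j := fun j => by
    rw [← EReal.coe_ennreal_le_coe_ennreal_iff, ← hcoe]
    exact permitRevenue_le_optProfitOn hC j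
  gcongr with j _ j _
  · exact h1 j
  · exact h2 j

end Marginal

end ProfitMax

end

/-! ### The main theorem. -/

theorem mainTheorem5 :
    ∃ K : ℝ, 0 < K ∧
      ∀ (m : ℕ) (_ : 1 ≤ m) (D : Fin m → Measure ℝ) (C : Measure (Fin m → ℝ))
        (_ : ∀ j, IsProbabilityMeasure (D j)) (_ : IsProbabilityMeasure C)
        (_ : ∀ j, ∀ᵐ x ∂(D j), 0 ≤ x) (_ : ∀ᵐ c ∂C, ∀ j, 0 ≤ c j),
        ProfitMax.optProfit D C ≤
            ProfitMax.ipProfit D C + ((K * Real.log m : ℝ) : EReal) * ProfitMax.ppProfit D C ∧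
          ProfitMax.optProfit D C ≤
            ((K * (1 + Real.log m) : ℝ) : EReal) * ∑ j, ProfitMax.optProfitOn D C {j} ∧
          ∀ j, Tendsto (fun v : ℝ => v * (D j).real (Set.Ici v)) atTop (𝓝 0) →
            ProfitMax.optProfitOn D C {j} =
              ((∫⁻ z, ENNReal.ofReal (ProfitMax.ironedVirtualValue (D j) z.1 - z.2)
                  ∂((D j).prod (C.map fun c => c j)) : ℝ≥0∞) : EReal) := by
  -- The constant `3` comes from `1 + log m ≤ 3 log m` for `m ≥ 2`; it also covers `1 + 3 log m ≤ 3
  -- (1 + log m)`.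
  refine ⟨3, by norm_num, fun m hm D C hD hC hD0 hC0 => ?_⟩
  have : Nonempty (Fin m) := ⟨⟨0, hm⟩⟩
  have hlog : 0 ≤ Real.log m := Real.log_natCast_nonneg m
  have hmain := ProfitMax.optProfit_le_log hD0 hC0
  rw [Fintype.card_fin] at hmain
  have hlog3 : 0 ≤ 3 * Real.log m := by positivity
  refine ⟨hmain.trans ?_, hmain.trans ?_, fun j hlim => ?_⟩
  · rw [EReal.coe_ennreal_add, EReal.coe_ennreal_mul, EReal.coe_ennreal_ofReal,
      max_eq_left hlog3]
    refine add_le_add ProfitMax.sum_singleProfit_le_ipProfit ?_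
    exact mul_le_mul_of_nonneg_left (ProfitMax.sum_permitRevenue_le_ppProfit hC0)
      (EReal.coe_nonneg.mpr hlog3)
  · refine (ProfitMax.coe_ofReal_mul_sum_le (D := D) (C := C) hC0 hlog3).trans ?_
    refine mul_le_mul_of_nonneg_right (EReal.coe_le_coe_iff.mpr (by linarith)) ?_
    exact Finset.sum_nonneg fun j _ => ProfitMax.optProfitOn_singleton_nonneg (D := D) hC0 j
  · have : IsProbabilityMeasure (C.map fun c => c j) :=
      Measure.isProbabilityMeasure_map (measurable_pi_apply j).aemeasurable
    rw [ProfitMax.optProfitOn_singleton hD0 hC0, ProfitMax.singleProfit_eq (hD0 j) hlim]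
    exact (ae_map_iff (f := fun c : Fin m → ℝ => c j) (measurable_pi_apply j).aemeasurable
      measurableSet_Ici).mpr (ProfitMax.ae_nonneg_apply hC0 j)
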